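/- **Model.** Let $a\ge 2$, $d\in\mathbb N$, and let $X_{ik}=\mu_i+\epsilon_{ik}$ ($i=1,\dots,a$, $k=1,2,\dots$) be independent $\mathbb R^d$-valued random vectors, where $\mu_i\in\mathbb R^d$ and, for fixed $i$ and $j$, the variables $\epsilon_{ikj}$, $k\ge1$, are identically distributed with mean $0$. Group $i$ contributes $X_{i1},\dots,X_{in_i}$ to the data, and $N=\sum_i n_i\to\infty$. Let $\bigoplus$ denote the block diagonal direct sum. Assume * (A1) $n_i/N\to\kappa_i\in(0,1]$ for $i=1,\dots,a$; * (A2) $\operatorname{Var}(\epsilon_{ik})=\Sigma_i$ exists (finite second moments) and does not depend on $k$, for $i=1,\dots,a$. Put $\Sigma=\bigoplus_{i=1}^a\kappa_i^{-1}\Sigma_i$ and $\Sigma^{(j)}=\operatorname{diag}(\kappa_1^{-1}(\Sigma_1)_{jj},\dots,\kappa_a^{-1}(\Sigma_a)_{jj})$, $j=1,\dots,d$. **Bootstrap.** Let $\widehat\Sigma_i$ be the empirical covariance matrix (normalized by $n_i-1$) of group $i$. Given the data, let $X^\star_{ik}$ ($1\le i\le a$, $1\le k\le n_i$) be independent with $X_{ik}^\star\sim\mathcal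 N_d(0,\widehat\Sigma_i)$. Let $\overline X^\star_i=n_i^{-1}\sum_kX^\star_{ik}$, let $\overline X^\star\in\mathbb R^{ad}$ be the stacked vector of the $\overline X^\star_i$, and let $\overline X^{(j)\star}=(\overline X^\star_{1j},\dots,\overline X^\star_{aj})^\top$. Let $\widehat\Sigma_i^\star$ be the empirical covariance matrix of $X^\star_{i1},\dots,X^\star_{in_i}$, and put $\widehat\Sigma^\star=N\bigoplus_in_i^{-1}\widehat\Sigma_i^\star$ and $\widehat\Sigma^{(j)\star}=N\operatorname{diag}(n_1^{-1}(\widehat\Sigma_1^\star)_{jj},\dots,n_a^{-1}(\widehat\Sigma_a^\star)_{jj})$. **Quadratic forms.** For a matrix $C$, a weight matrix $W$, a covariance matrix $S$ and a vector $z$ let $v(C,W,S)=2\operatorname{tr}([C^\top WCS]^2)$ and $$q_N(C,W,S,z)=N\,\frac{[Cz]^\top W[Cz]}{\sqrt{v(C,W,S)}}\ \text{ if } v(C,W,S)>0,\qquad q_N(C,W,S,z)=0\ \text{ otherwise}.$$ Let $P_a=I_a-\mathbf 1_a\mathbf 1_a^\top/a$, let $C_\ell\in\mathbb R^{r_\ell\times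 ad}$ for $\ell=1,\dots,L$, and let $\widetilde M(\cdot,\cdot)$ and $M(\cdot,\cdot)$ be matrix-valued functions, with values in $\mathbb R^{a\times a}$ and, at $(C_\ell,\cdot)$, in $\mathbb R^{r_\ell\times r_\ell}$. Put $$\widetilde Q^\star_{Nj}=q_N\bigl(P_a,\widetilde M(P_a,\widehat\Sigma^{(j)\star}),\widehat\Sigma^{(j)\star},\overline X^{(j)\star}\bigr),\qquad Q^\star_{N\ell}=q_N\bigl(C_\ell,M(C_\ell,\widehat\Sigma^\star),\widehat\Sigma^\star,\overline X^\star\bigr),$$ $\widetilde Q_N^\star=(\widetilde Q_{Nj}^\star)_{j\le d}$ and $Q_N^\star=(Q_{N\ell}^\star)_{\ell\le L}$. A weight function $S\mapsto W(S)$ is called *admissible at* $S_0$ if it is Borel measurable, $W(S)$ is symmetric and positive semidefinite whenever $S$ is, and $W(S_m)\to W(S_0)$ for all positive semidefinite $S_m\to S_0$ with $\ker S_0\subseteq\ker S_m$ (continuity at $S_0$ on the positive semidefinite matrices suffices). Let $Z=(Z_{ij})\sim\mathcal N_{ad}(0,\Sigma)$, where $i\le a$ indexes groups and $j\le d$ components,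 $Z^{(j)}=(Z_{1j},\dots,Z_{aj})^\top$, and $$\widetilde Q=\Bigl(\widetilde v_{jj}^{-1/2}[P_aZ^{(j)}]^\top\widetilde M(P_a,\Sigma^{(j)})[P_aZ^{(j)}]\Bigr)_{j\le d},\qquad Q=\Bigl(v_{\ell\ell}^{-1/2}[C_\ell Z]^\top M(C_\ell,\Sigma)[C_\ell Z]\Bigr)_{\ell\le L},$$ with $\widetilde v_{jj}=v(P_a,\widetilde M(P_a,\Sigma^{(j)}),\Sigma^{(j)})$ and $v_{\ell\ell}=v(C_\ell,M(C_\ell,\Sigma),\Sigma)$. "Given the data, the conditional distribution of $T_N$ converges weakly to $\nu$ in probability" means: for every bounded continuous real function $f$, the integral of $f$ with respect to the conditional distribution of $T_N$ given the data converges in probability to $\int f\,d\nu$. **Theorem.** Under (A1) and (A2), as $N\to\infty$: * (a) given the data, the conditional distribution of $\sqrt N\,\overline X^\star$ converges weakly to $\mathcal N_{ad}(0,\Sigma)$ in probability; * (b) if, for every $j$, $\widetilde M(P_a,\cdot)$ is admissible at $\Sigma^{(j)}$ and $\widetilde v_{jj}>0$, then, given the data, the conditional distribution of $\widetilde Q_N^\star$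 converges weakly to the law of $\widetilde Q$ in probability; * (c) if, for every $\ell$, $M(C_\ell,\cdot)$ is admissible at $\Sigma$ and, (A3), $C_\ell^\top M(C_\ell,\Sigma)C_\ell\Sigma$ has a nonzero eigenvalue, then, given the data, the conditional distribution of $Q_N^\star$ converges weakly to the law of $Q$ in probability. Moreover $\widehat\Sigma^\star\to\Sigma$ in probability. -/

import Mathlib

open MeasureTheory ProbabilityTheory Filter Topology Matrix
open scoped BoundedContinuousFunction

noncomputable section

namespace QuadBootstrap

/-- A sample of `a` groups of `d`-dimensional observations, the `i`-th group having size `n i`. -/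
abbrev Sample {a : ℕ} (n : Fin a → ℕ) (d : ℕ) : Type :=
  (i : Fin a) → Fin (n i) → EuclideanSpace ℝ (Fin d)

/-- The total sample size `N = n_1 + ... + n_a`. -/
def totalSize {a : ℕ} (n : Fin a → ℕ) : ℕ := ∑ i, n i

/-- The mean vector of the `i`-th group. -/
def groupMean {a d : ℕ} {n : Fin a → ℕ} (x : Sample n d) (i : Fin a) :
    EuclideanSpace ℝ (Fin d) :=
  (n i : ℝ)⁻¹ • ∑ k, x i k

/-- The stacked vector of all group means; the entry `(i, j)` belongs to group `i` and
component `j`. -/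
def meanVec {a d : ℕ} {n : Fin a → ℕ} (x : Sample n d) : EuclideanSpace ℝ (Fin a × Fin d) :=
  WithLp.toLp 2 fun p => groupMean x p.1 p.2

/-- The vector `(X̄_{1j}, ..., X̄_{aj})` of the group means of the `j`-th component. -/
def componentMean {a d : ℕ} {n : Fin a → ℕ} (x : Sample n d) (j : Fin d) : Fin a → ℝ :=
  fun i => groupMean x i j

/-- The empirical covariance matrix of the `i`-th group. -/
def groupCov {a d : ℕ} {n : Fin a → ℕ} (x : Sample n d) (i : Fin a) :
    Matrix (Fin d) (Fin d) ℝ :=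
  ((n i : ℝ) - 1)⁻¹ • Matrix.of fun j j' =>
    ∑ k, (x i k j - groupMean x i j) * (x i k j' - groupMean x i j')

/-- The direct sum `S_1 ⊕ ... ⊕ S_a`, indexed by pairs (group, component). -/
def directSum {a d : ℕ} (S : Fin a → Matrix (Fin d) (Fin d) ℝ) :
    Matrix (Fin a × Fin d) (Fin a × Fin d) ℝ :=
  Matrix.of fun p q => if p.1 = q.1 then S p.1 p.2 q.2 else 0

/-- The pooled covariance estimator `N ⊕ᵢ nᵢ⁻¹ Σ̂ᵢ`. -/
def pooledCov {a d : ℕ} {n : Fin a → ℕ} (x : Sample n d) :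
    Matrix (Fin a × Fin d) (Fin a × Fin d) ℝ :=
  (totalSize n : ℝ) • directSum fun i => (n i : ℝ)⁻¹ • groupCov x i

/-- The estimator `N diag(n₁⁻¹ (Σ̂₁)ⱼⱼ, ..., nₐ⁻¹ (Σ̂ₐ)ⱼⱼ)` for the `j`-th component. -/
def componentCov {a d : ℕ} {n : Fin a → ℕ} (x : Sample n d) (j : Fin d) :
    Matrix (Fin a) (Fin a) ℝ :=
  (totalSize n : ℝ) • Matrix.diagonal fun i => (n i : ℝ)⁻¹ * groupCov x i j j

/-- `Σ = ⊕ᵢ κᵢ⁻¹ Σᵢ`. -/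
def limitCov {a d : ℕ} (κ : Fin a → ℝ) (S : Fin a → Matrix (Fin d) (Fin d) ℝ) :
    Matrix (Fin a × Fin d) (Fin a × Fin d) ℝ :=
  directSum fun i => (κ i)⁻¹ • S i

/-- `Σ⁽ʲ⁾ = diag(κ₁⁻¹ (Σ₁)ⱼⱼ, ..., κₐ⁻¹ (Σₐ)ⱼⱼ)`. -/
def limitComponentCov {a d : ℕ} (κ : Fin a → ℝ) (S : Fin a → Matrix (Fin d) (Fin d) ℝ)
    (j : Fin d) : Matrix (Fin a) (Fin a) ℝ :=
  Matrix.diagonal fun i => (κ i)⁻¹ * S i j j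

/-- The centering matrix `P_a = I_a - 1_a 1_aᵀ / a`. -/
def centering (a : ℕ) : Matrix (Fin a) (Fin a) ℝ :=
  1 - (a : ℝ)⁻¹ • Matrix.of fun _ _ => 1

/-- The quadratic form `[C z]ᵀ W [C z]`. -/
def quadForm {r p : Type*} [Fintype r] [Fintype p] (C : Matrix r p ℝ) (W : Matrix r r ℝ)
    (z : p → ℝ) : ℝ :=
  (C *ᵥ z) ⬝ᵥ (W *ᵥ (C *ᵥ z))

/-- `2 tr([Cᵀ W C S]²)`. -/
def formVar {r p : Type*} [Fintype r] [Fintype p] [DecidableEq p] (C : Matrix r p ℝ)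
    (W : Matrix r r ℝ) (S : Matrix p p ℝ) : ℝ :=
  2 * ((Cᵀ * W * C * S) ^ 2).trace

/-- The standardized quadratic form
`N · [C z]ᵀ W [C z] / √(2 tr([Cᵀ W C S]²)) · 1(tr([Cᵀ W C S]²) > 0)`. -/
def stdQuadForm {r p : Type*} [Fintype r] [Fintype p] [DecidableEq p] (N : ℝ)
    (C : Matrix r p ℝ) (W : Matrix r r ℝ) (S : Matrix p p ℝ) (z : p → ℝ) : ℝ :=
  if 0 < formVar C W S then N * (quadForm C W z / √(formVar C W S)) else 0

/-- The vector `Q̃_N` of a sample: its `j`-th entry is formed with `P_a`, the weight matrix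
`M̃(P_a, Σ̂⁽ʲ⁾)` and the group means of component `j`. -/
def equalityForms {a d : ℕ} {n : Fin a → ℕ}
    (Mt : Matrix (Fin a) (Fin a) ℝ → Matrix (Fin a) (Fin a) ℝ → Matrix (Fin a) (Fin a) ℝ)
    (x : Sample n d) : Fin d → ℝ :=
  fun j => stdQuadForm (totalSize n) (centering a) (Mt (centering a) (componentCov x j))
    (componentCov x j) (componentMean x j)

/-- The vector `Q_N` of a (centred) sample: its `ℓ`-th entry is formed with `C_ℓ`, the weight
matrix `M(C_ℓ, Σ̂)` and the stacked mean vector. -/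
def generalForms {a d L : ℕ} {n : Fin a → ℕ} {r : Fin L → ℕ}
    (C : (l : Fin L) → Matrix (Fin (r l)) (Fin a × Fin d) ℝ)
    (M : (s : ℕ) → Matrix (Fin s) (Fin a × Fin d) ℝ →
      Matrix (Fin a × Fin d) (Fin a × Fin d) ℝ → Matrix (Fin s) (Fin s) ℝ)
    (x : Sample n d) : Fin L → ℝ :=
  fun l => stdQuadForm (totalSize n) (C l) (M (r l) (C l) (pooledCov x)) (pooledCov x)
    (meanVec x)

/-- The law of `Q̃ = (ṽⱼⱼ^(-1/2) [P_a Z⁽ʲ⁾]ᵀ M̃(P_a, Σ⁽ʲ⁾) [P_a Z⁽ʲ⁾])ⱼ`, where `Z ~ N(0, Σ)` and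
`Z⁽ʲ⁾ = (Z_{1j}, ..., Z_{aj})`. -/
def equalityLimit {a d : ℕ} (κ : Fin a → ℝ) (S : Fin a → Matrix (Fin d) (Fin d) ℝ)
    (Mt : Matrix (Fin a) (Fin a) ℝ → Matrix (Fin a) (Fin a) ℝ → Matrix (Fin a) (Fin a) ℝ) :
    Measure (Fin d → ℝ) :=
  (multivariateGaussian 0 (limitCov κ S)).map fun z j =>
    let W := Mt (centering a) (limitComponentCov κ S j)
    (√(formVar (centering a) W (limitComponentCov κ S j)))⁻¹ *
      quadForm (centering a) W fun i => z (i, j)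

/-- The law of `Q = (v_ℓℓ^(-1/2) [C_ℓ Z]ᵀ M(C_ℓ, Σ) [C_ℓ Z])_ℓ`, where `Z ~ N(0, Σ)`. -/
def generalLimit {a d L : ℕ} {r : Fin L → ℕ} (κ : Fin a → ℝ)
    (S : Fin a → Matrix (Fin d) (Fin d) ℝ)
    (C : (l : Fin L) → Matrix (Fin (r l)) (Fin a × Fin d) ℝ)
    (M : (s : ℕ) → Matrix (Fin s) (Fin a × Fin d) ℝ →
      Matrix (Fin a × Fin d) (Fin a × Fin d) ℝ → Matrix (Fin s) (Fin s) ℝ) :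
    Measure (Fin L → ℝ) :=
  (multivariateGaussian 0 (limitCov κ S)).map fun (z : EuclideanSpace ℝ (Fin a × Fin d)) l =>
    let W := M (r l) (C l) (limitCov κ S)
    (√(formVar (C l) W (limitCov κ S)))⁻¹ * quadForm (C l) W (WithLp.ofLp z)

/-- The requirements on a weight function `S ↦ W S` (that is, `S ↦ M(C, S)` for a fixed `C`) at
the limiting covariance matrix `S₀`: it is Borel measurable, its values at covariance matrices
are symmetric and positive semidefinite, and `W S → W S₀` as `S → S₀` through covariance
matrices `S` with `ker S₀ ⊆ ker S`. -/
structure IsWeight {r p : Type*} [Fintype r] [Fintype p]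
    (W : Matrix p p ℝ → Matrix r r ℝ) (S₀ : Matrix p p ℝ) : Prop where
  measurable_entry : ∀ s t, Measurable fun A : p → p → ℝ => W (Matrix.of A) s t
  posSemidef : ∀ S, S.PosSemidef → (W S).PosSemidef
  continuousWithinAt :
    ContinuousWithinAt W {S | S.PosSemidef ∧ ∀ v, S₀ *ᵥ v = 0 → S *ᵥ v = 0} S₀

/-- `Xs` is a parametric bootstrap sample for the random sample `X`: given `X`, the vectors
`Xs i k` are independent with law `N(0, Σ̂ᵢ)`, where `Σ̂ᵢ` is the empirical covariance matrix of
the `i`-th group of `X`. -/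
structure IsParametricBootstrap {Ω : Type*} [MeasurableSpace Ω] (P : Measure Ω)
    [IsFiniteMeasure P] {a d : ℕ} {n : Fin a → ℕ} (X Xs : Ω → Sample n d) : Prop where
  measurable : Measurable Xs
  condLaw : ∀ᵐ x ∂(P.map X), condDistrib Xs X P x =
    Measure.pi fun i => Measure.pi fun _ : Fin (n i) => multivariateGaussian 0 (groupCov x i)

/-- Given the data `X m`, the conditional distribution of `T m` converges weakly to `ν` in
probability: for every bounded continuous `f`, the integral of `f` against the conditional
distribution of `T m` given `X m` converges in probability to `∫ f dν`. -/
def CondTendstoWeakly {Ω : Type*} [MeasurableSpace Ω] (P : Measure Ω) [IsFiniteMeasure P]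
    {D : ℕ → Type*} [∀ m, MeasurableSpace (D m)] (X : (m : ℕ) → Ω → D m)
    {E : Type*} [TopologicalSpace E] [PolishSpace E] [MeasurableSpace E] [BorelSpace E] [Nonempty E]
    (T : ℕ → Ω → E) (ν : Measure E) : Prop :=
  ∀ f : E →ᵇ ℝ, TendstoInMeasure P
    (fun m ω => ∫ z, f z ∂(condDistrib (T m) (X m) P (X m ω))) atTop (fun _ => ∫ z, f z ∂ν)

end QuadBootstrap

end

/-!
The theorem is reduced to a statement about deterministic covariance matrices. Given the data, the
bootstrap sample has the law `bootLaw n A`, where `A i` is the empirical covariance matrix of group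
`i`. By `exists_subseq_tendsto_groupCov`, every subsequence of the data has a further subsequence
along which, almost surely, these matrices tend to the true covariance matrices `S i`, and almost
surely the kernel of `S i` is contained in theirs. By the subsequence criterion for convergence in
probability it therefore suffices (`condTendstoWeakly_of_bootLaw`) to find the limit of the laws of
a statistic under `bootLaw (n m) (A m)` for deterministic sequences `A m i → S i` of positive
semidefinite matrices with `ker (S i) ⊆ ker (A m i)` (`IsCovSeq`).

For the data, the products `ε_{ikj} ε_{ikj'}` are independent in `k` but need not be identically
distributed, since only the marginals of the errors are. They are controlled by the squares of the
two factors, and a truncation gives a weak law of large numbers in `L¹`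
(`tendsto_integral_abs_average_mul_sub`).

For deterministic `A m`, all bootstrap samples are realized on one probability space as
`A_i^(1/2) G_{ik}` with independent standard Gaussian vectors `G_{ik}`. There
`nᵢ^(-1/2) ∑_{k < nᵢ} G_{ik}` is exactly standard Gaussian, the matrix square root is continuous, and
the strong law of large numbers makes the bootstrap covariance matrices converge almost surely
(`ae_tendsto_groupCov_coupled`). Slutsky's theorem then yields the joint limit of the rescaled mean
vector and any consistent statistic (`tendsto_integral_bootLaw`).

The standardized quadratic forms are continuous functions of the rescaled mean vector and of the
weights divided by the root of the variance (`stdQuadForm_eq`). These normalized weights are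
consistent when the limiting variance is positive, because the coupling preserves the inclusion of
kernels that the weight functions require (`IsWeight.tendsto_stdWeight`). A nonzero eigenvalue of
`Cᵀ W C Σ` makes the limiting variance positive (`formVar_pos`). Finally, the consistency of the
pooled covariance matrix is conditional convergence to a constant, which implies unconditional
convergence in probability (`CondTendstoWeakly.tendstoInMeasure`).
-/

noncomputable section

namespace QuadBootstrap

/-! ### Algebra of covariance matrices -/

/-- The empirical covariances in terms of empirical moments about an arbitrary point `c`. The
identity includes groups of size `0` and `1`, for which both sides vanish. -/
lemma groupCov_apply_eq {a d : ℕ} {n : Fin a → ℕ} (x : Sample n d) (i : Fin a)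
    (c : EuclideanSpace ℝ (Fin d)) (j j' : Fin d) :
    groupCov x i j j' = (n i : ℝ) / ((n i : ℝ) - 1) *
      ((n i : ℝ)⁻¹ * ∑ k, (x i k j - c j) * (x i k j' - c j') -
        ((n i : ℝ)⁻¹ * ∑ k, (x i k j - c j)) * ((n i : ℝ)⁻¹ * ∑ k, (x i k j' - c j'))) := by
  rcases Nat.eq_zero_or_pos (n i) with h0 | h0
  · have : IsEmpty (Fin (n i)) := by rw [h0]; infer_instance
    simp [groupCov, h0]
  have hn : (n i : ℝ) ≠ 0 := by positivity
  have hm : ∀ j, groupMean x i j = c j + (n i : ℝ)⁻¹ * ∑ k, (x i k j - c j) := by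
    intro j
    simp [groupMean, Finset.sum_sub_distrib, mul_sub, hn]
  simp only [groupCov, Matrix.smul_apply, of_apply, smul_eq_mul, hm]
  set u : Fin (n i) → ℝ := fun k => x i k j - c j
  set v : Fin (n i) → ℝ := fun k => x i k j' - c j'
  have key : ∑ k, (x i k j - (c j + (n i : ℝ)⁻¹ * ∑ k, u k)) *
      (x i k j' - (c j' + (n i : ℝ)⁻¹ * ∑ k, v k)) =
      ∑ k, u k * v k - (n i : ℝ)⁻¹ * (∑ k, u k) * ∑ k, v k := by
    have : ∀ k, (x i k j - (c j + (n i : ℝ)⁻¹ * ∑ k, u k)) *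
      (x i k j' - (c j' + (n i : ℝ)⁻¹ * ∑ k, v k)) =
      u k * v k - ((n i : ℝ)⁻¹ * ∑ k, v k) * u k - ((n i : ℝ)⁻¹ * ∑ k, u k) * v k
        + ((n i : ℝ)⁻¹ * ∑ k, u k) * ((n i : ℝ)⁻¹ * ∑ k, v k) := by
      intro k; simp only [u, v]; ring
    simp only [this, Finset.sum_add_distrib, Finset.sum_sub_distrib, ← Finset.mul_sum,
      Finset.sum_const, Finset.card_univ, Fintype.card_fin, nsmul_eq_mul]
    field_simp
    ring
  rw [key]
  have : ∑ k, u k * v k - (n i : ℝ)⁻¹ * (∑ k, u k) * ∑ k, v k = (n i : ℝ) *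
      ((n i : ℝ)⁻¹ * ∑ k, u k * v k - ((n i : ℝ)⁻¹ * ∑ k, u k) * ((n i : ℝ)⁻¹ * ∑ k, v k)) := by
    field_simp
  rw [this]
  ring

/-- Empirical covariances converge when the first two empirical moments of the errors do. -/
lemma tendsto_groupCov {a d : ℕ} {n : ℕ → Fin a → ℕ} (x : (m : ℕ) → Sample (n m) d) (i : Fin a)
    (c : EuclideanSpace ℝ (Fin d)) (e : ℕ → EuclideanSpace ℝ (Fin d))
    (hx : ∀ m k, x m i k = c + e k) (hn : Tendsto (fun m => n m i) atTop atTop)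
    (T : Matrix (Fin d) (Fin d) ℝ)
    (h1 : ∀ j, Tendsto (fun m => (n m i : ℝ)⁻¹ * ∑ k ∈ Finset.range (n m i), e k j) atTop (𝓝 0))
    (h2 : ∀ j j', Tendsto (fun m => (n m i : ℝ)⁻¹ * ∑ k ∈ Finset.range (n m i), e k j * e k j')
      atTop (𝓝 (T j j'))) :
    Tendsto (fun m => groupCov (x m) i) atTop (𝓝 T) := by
  refine tendsto_pi_nhds.2 fun j => tendsto_pi_nhds.2 fun j' => ?_
  have hq : Tendsto (fun m => (n m i : ℝ) / ((n m i : ℝ) - 1)) atTop (𝓝 1) := by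
    have h : Tendsto (fun k : ℕ => (k : ℝ) / ((k : ℝ) - 1)) atTop (𝓝 1) := by
      simpa [sub_eq_add_neg] using tendsto_natCast_div_add_atTop (-1 : ℝ)
    exact h.comp hn
  have := hq.mul ((h2 j j').sub ((h1 j).mul (h1 j')))
  simp only [mul_zero, sub_zero, one_mul] at this
  refine this.congr fun m => ?_
  rw [groupCov_apply_eq (x m) i c j j']
  simp [hx, Finset.sum_range]

lemma groupCov_eq_smul {a d : ℕ} {n : Fin a → ℕ} (x : Sample n d) (i : Fin a) :
    groupCov x i = ((n i : ℝ) - 1)⁻¹ •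
      ((Matrix.of fun (k : Fin (n i)) j => x i k j - groupMean x i j)ᵀ *
        (Matrix.of fun (k : Fin (n i)) j => x i k j - groupMean x i j)) := by
  ext j j'
  simp [groupCov, Matrix.mul_apply]

lemma groupCov_posSemidef {a d : ℕ} {n : Fin a → ℕ} (x : Sample n d) (i : Fin a) :
    (groupCov x i).PosSemidef := by
  rw [groupCov_eq_smul]
  -- for an empty group the factor `(n - 1)⁻¹` is negative, but the Gram matrix vanishes
  rcases Nat.eq_zero_or_pos (n i) with h0 | h0
  · have : IsEmpty (Fin (n i)) := by rw [h0]; infer_instance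
    have h : ((Matrix.of fun (k : Fin (n i)) j => x i k j - groupMean x i j)ᵀ *
        (Matrix.of fun (k : Fin (n i)) j => x i k j - groupMean x i j)) = 0 := by
      ext; simp [Matrix.mul_apply]
    rw [h, smul_zero]
    exact PosSemidef.zero
  · refine PosSemidef.smul ?_ ?_
    · simpa [conjTranspose_eq_transpose_of_trivial] using
        posSemidef_conjTranspose_mul_self (R := ℝ)
          (Matrix.of fun (k : Fin (n i)) j => x i k j - groupMean x i j)
    · rw [inv_nonneg, sub_nonneg]
      exact_mod_cast h0

lemma groupMean_toEuclideanCLM {a d : ℕ} {n : Fin a → ℕ} (B : Fin a → Matrix (Fin d) (Fin d) ℝ)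
    (g : Sample n d) (i : Fin a) :
    groupMean (fun i k => toEuclideanCLM (𝕜 := ℝ) (B i) (g i k) : Sample n d) i =
      toEuclideanCLM (𝕜 := ℝ) (B i) (groupMean g i) := by
  simp [groupMean, map_sum]

lemma groupCov_toEuclideanCLM {a d : ℕ} {n : Fin a → ℕ} (B : Fin a → Matrix (Fin d) (Fin d) ℝ)
    (g : Sample n d) (i : Fin a) :
    groupCov (fun i k => toEuclideanCLM (𝕜 := ℝ) (B i) (g i k) : Sample n d) i =
      B i * groupCov g i * (B i)ᵀ := by
  rw [groupCov_eq_smul, groupCov_eq_smul, Matrix.mul_smul, Matrix.smul_mul]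
  congr 1
  have : (Matrix.of fun (k : Fin (n i)) j => toEuclideanCLM (𝕜 := ℝ) (B i) (g i k) j -
      groupMean (fun i k => toEuclideanCLM (𝕜 := ℝ) (B i) (g i k) : Sample n d) i j) =
      (Matrix.of fun (k : Fin (n i)) j => g i k j - groupMean g i j) * (B i)ᵀ := by
    ext k j
    rw [groupMean_toEuclideanCLM]
    simp only [of_apply, Matrix.mul_apply, transpose_apply]
    rw [← PiLp.sub_apply, ← map_sub, ofLp_toEuclideanCLM, mulVec, dotProduct]
    exact Finset.sum_congr rfl fun p _ => by simp [mul_comm]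
  rw [this]
  simp [Matrix.mul_assoc]

lemma directSum_mulVec {a d : ℕ} (S : Fin a → Matrix (Fin d) (Fin d) ℝ) (v : Fin a × Fin d → ℝ)
    (p : Fin a × Fin d) : (directSum S *ᵥ v) p = (S p.1 *ᵥ fun j => v (p.1, j)) p.2 := by
  simp [mulVec, dotProduct, directSum, Fintype.sum_prod_type]

lemma dotProduct_directSum_mulVec {a d : ℕ} (S : Fin a → Matrix (Fin d) (Fin d) ℝ)
    (v : Fin a × Fin d → ℝ) :
    v ⬝ᵥ (directSum S *ᵥ v) = ∑ i, (fun j => v (i, j)) ⬝ᵥ (S i *ᵥ fun j => v (i, j)) := by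
  rw [dotProduct, Fintype.sum_prod_type]
  simp only [directSum_mulVec]
  rfl

lemma directSum_posSemidef {a d : ℕ} {S : Fin a → Matrix (Fin d) (Fin d) ℝ}
    (hS : ∀ i, (S i).PosSemidef) : (directSum S).PosSemidef := by
  refine PosSemidef.of_dotProduct_mulVec_nonneg ?_ fun v => ?_
  · ext p q
    by_cases h : p.1 = q.1
    · have := (hS q.1).isHermitian.apply q.2 p.2
      simpa [directSum, h, eq_comm] using this
    · simp [directSum, h, Ne.symm h]
  · rw [star_trivial, dotProduct_directSum_mulVec]
    exact Finset.sum_nonneg fun i _ => by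
      simpa using (hS i).dotProduct_mulVec_nonneg fun j => v (i, j)

lemma limitCov_posSemidef {a d : ℕ} {κ : Fin a → ℝ} (hκ : ∀ i, 0 < κ i)
    {S : Fin a → Matrix (Fin d) (Fin d) ℝ} (hS : ∀ i, (S i).PosSemidef) :
    (limitCov κ S).PosSemidef :=
  directSum_posSemidef fun i => (hS i).smul (inv_nonneg.2 (hκ i).le)

lemma pooledCov_posSemidef {a d : ℕ} {n : Fin a → ℕ} (x : Sample n d) :
    (pooledCov x).PosSemidef :=
  (directSum_posSemidef fun i => (groupCov_posSemidef x i).smul (by positivity)).smul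
    (by positivity)

lemma componentCov_posSemidef {a d : ℕ} {n : Fin a → ℕ} (x : Sample n d) (j : Fin d) :
    (componentCov x j).PosSemidef := by
  refine PosSemidef.smul (PosSemidef.diagonal fun i => ?_) (by positivity)
  exact mul_nonneg (by positivity) (groupCov_posSemidef x i).diag_nonneg

lemma limitCov_apply {a d : ℕ} (κ : Fin a → ℝ) (S : Fin a → Matrix (Fin d) (Fin d) ℝ)
    (p q : Fin a × Fin d) :
    limitCov κ S p q = if p.1 = q.1 then (κ p.1)⁻¹ * S p.1 p.2 q.2 else 0 := by
  simp [limitCov, directSum]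

lemma pooledCov_apply {a d : ℕ} {n : Fin a → ℕ} (x : Sample n d) (p q : Fin a × Fin d) :
    pooledCov x p q =
      if p.1 = q.1 then (totalSize n : ℝ) / n p.1 * groupCov x p.1 p.2 q.2 else 0 := by
  simp [pooledCov, directSum, div_eq_mul_inv, mul_assoc]

lemma pooledCov_mulVec_eq_zero {a d : ℕ} {n : Fin a → ℕ} {κ : Fin a → ℝ} (hκ : ∀ i, 0 < κ i)
    {S : Fin a → Matrix (Fin d) (Fin d) ℝ} (x : Sample n d)
    (hker : ∀ i v, S i *ᵥ v = 0 → groupCov x i *ᵥ v = 0) (v : Fin a × Fin d → ℝ)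
    (hv : limitCov κ S *ᵥ v = 0) : pooledCov x *ᵥ v = 0 := by
  have h : ∀ i, S i *ᵥ (fun j => v (i, j)) = 0 := by
    intro i
    ext j
    have := congrFun hv (i, j)
    rw [limitCov, directSum_mulVec, smul_mulVec] at this
    simpa [(hκ i).ne'] using this
  ext p
  rw [pooledCov, smul_mulVec, Pi.smul_apply, directSum_mulVec, smul_mulVec, hker _ _ (h p.1)]
  simp

lemma componentCov_mulVec_eq_zero {a d : ℕ} {n : Fin a → ℕ} {κ : Fin a → ℝ} (hκ : ∀ i, 0 < κ i)
    {S : Fin a → Matrix (Fin d) (Fin d) ℝ} (hS : ∀ i, (S i).PosSemidef) (x : Sample n d)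
    (hker : ∀ i v, S i *ᵥ v = 0 → groupCov x i *ᵥ v = 0) (j : Fin d) (v : Fin a → ℝ)
    (hv : limitComponentCov κ S j *ᵥ v = 0) : componentCov x j *ᵥ v = 0 := by
  ext i
  have h := congrFun hv i
  simp only [limitComponentCov, mulVec_diagonal, Pi.zero_apply, mul_eq_zero, inv_eq_zero,
    (hκ i).ne', false_or] at h
  rw [componentCov, smul_mulVec, Pi.smul_apply, mulVec_diagonal]
  rcases h with h | h
  · have h0 : S i *ᵥ Pi.single j 1 = 0 := by
      rw [← (hS i).dotProduct_mulVec_zero_iff]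
      simpa using h
    have := congrFun (hker i _ h0) j
    simp only [mulVec_single_one, Pi.zero_apply] at this
    simp [show groupCov x i j j = 0 from this]
  · simp [h]

lemma tendsto_pooledCov {a d : ℕ} {n : ℕ → Fin a → ℕ} {κ : Fin a → ℝ} (hκ : ∀ i, 0 < κ i)
    {S : Fin a → Matrix (Fin d) (Fin d) ℝ}
    (hA1 : ∀ i, Tendsto (fun m => (n m i : ℝ) / (totalSize (n m) : ℝ)) atTop (𝓝 (κ i)))
    {x : (m : ℕ) → Sample (n m) d}
    (hx : ∀ i, Tendsto (fun m => groupCov (x m) i) atTop (𝓝 (S i))) :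
    Tendsto (fun m => pooledCov (x m)) atTop (𝓝 (limitCov κ S)) := by
  refine tendsto_pi_nhds.2 fun p => tendsto_pi_nhds.2 fun q => ?_
  simp only [pooledCov_apply, limitCov_apply]
  split_ifs
  · refine Tendsto.mul ?_ (tendsto_pi_nhds.1 (tendsto_pi_nhds.1 (hx p.1) p.2) q.2)
    simpa using (hA1 p.1).inv₀ (hκ p.1).ne'
  · exact tendsto_const_nhds

lemma tendsto_componentCov {a d : ℕ} {n : ℕ → Fin a → ℕ} {κ : Fin a → ℝ} (hκ : ∀ i, 0 < κ i)
    {S : Fin a → Matrix (Fin d) (Fin d) ℝ}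
    (hA1 : ∀ i, Tendsto (fun m => (n m i : ℝ) / (totalSize (n m) : ℝ)) atTop (𝓝 (κ i)))
    {x : (m : ℕ) → Sample (n m) d}
    (hx : ∀ i, Tendsto (fun m => groupCov (x m) i) atTop (𝓝 (S i))) (j : Fin d) :
    Tendsto (fun m => componentCov (x m) j) atTop (𝓝 (limitComponentCov κ S j)) := by
  refine tendsto_pi_nhds.2 fun p => tendsto_pi_nhds.2 fun q => ?_
  simp only [componentCov, limitComponentCov, Matrix.smul_apply, diagonal_apply, smul_eq_mul]
  split_ifs
  · simp only [← mul_assoc]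
    refine Tendsto.mul ?_ (tendsto_pi_nhds.1 (tendsto_pi_nhds.1 (hx p) j) j)
    simpa [div_eq_mul_inv, mul_comm] using (hA1 p).inv₀ (hκ p).ne'
  · simp

/-! ### Square roots of positive semidefinite matrices -/

section Sqrt

open scoped MatrixOrder Matrix.Norms.L2Operator

/-- The positive semidefinite square root of a positive semidefinite matrix, as used in the
construction of `multivariateGaussian`. -/
def psdSqrt {p : Type*} [Fintype p] [DecidableEq p] (S : Matrix p p ℝ) : Matrix p p ℝ :=
  CFC.sqrt S

lemma transpose_psdSqrt {p : Type*} [Fintype p] [DecidableEq p] (S : Matrix p p ℝ) :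
    (psdSqrt S)ᵀ = psdSqrt S := by
  have := (CFC.sqrt_nonneg S).isSelfAdjoint.star_eq
  rwa [star_eq_conjTranspose, conjTranspose_eq_transpose_of_trivial] at this

lemma psdSqrt_mul_psdSqrt {p : Type*} [Fintype p] [DecidableEq p] {S : Matrix p p ℝ}
    (hS : S.PosSemidef) : psdSqrt S * psdSqrt S = S :=
  CFC.sqrt_mul_sqrt_self S hS.nonneg

lemma tendsto_psdSqrt {p : Type*} [Fintype p] [DecidableEq p] {A : ℕ → Matrix p p ℝ}
    {S : Matrix p p ℝ} (hA : ∀ m, (A m).PosSemidef) (hS : S.PosSemidef)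
    (h : Tendsto A atTop (𝓝 S)) :
    Tendsto (fun m => psdSqrt (A m)) atTop (𝓝 (psdSqrt S)) :=
  (CFC.continuousOn_sqrt (A := Matrix p p ℝ) S hS.nonneg).tendsto.comp
    (tendsto_nhdsWithin_iff.2 ⟨h, .of_forall fun m => (hA m).nonneg⟩)

lemma map_stdGaussian_psdSqrt {p : Type*} [Fintype p] [DecidableEq p] (S : Matrix p p ℝ) :
    (stdGaussian (EuclideanSpace ℝ p)).map (toEuclideanCLM (𝕜 := ℝ) (psdSqrt S)) =
      multivariateGaussian 0 S := by
  simp [multivariateGaussian, psdSqrt]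

end Sqrt

lemma psdSqrt_mulVec_eq_zero {p : Type*} [Fintype p] [DecidableEq p] {S : Matrix p p ℝ}
    (hS : S.PosSemidef) {v : p → ℝ} (hv : S *ᵥ v = 0) : psdSqrt S *ᵥ v = 0 := by
  have h : (psdSqrt S *ᵥ v) ⬝ᵥ (psdSqrt S *ᵥ v) = 0 := by
    rw [dotProduct_mulVec, vecMul_mulVec, transpose_psdSqrt, psdSqrt_mul_psdSqrt hS,
      ← dotProduct_mulVec, hv, dotProduct_zero]
  exact dotProduct_self_eq_zero.1 h

/-! ### Standardized quadratic forms -/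

/-- The weight matrix `v(C, W, S)^(-1/2) W`, with the convention `0` when `v(C, W, S) ≤ 0`: it
absorbs the standardization, so that `stdQuadForm` becomes a polynomial in this matrix and in the
rescaled mean vector. -/
def stdWeight {r p : Type*} [Fintype r] [Fintype p] [DecidableEq p] (C : Matrix r p ℝ)
    (W : Matrix r r ℝ) (S : Matrix p p ℝ) : Matrix r r ℝ :=
  if 0 < formVar C W S then (√(formVar C W S))⁻¹ • W else 0

lemma stdQuadForm_eq {r p : Type*} [Fintype r] [Fintype p] [DecidableEq p] (N : ℕ)
    (C : Matrix r p ℝ) (W : Matrix r r ℝ) (S : Matrix p p ℝ) (z : p → ℝ) :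
    stdQuadForm N C W S z = quadForm C (stdWeight C W S) (√(N : ℝ) • z) := by
  have h : √(N : ℝ) * √(N : ℝ) = N := Real.mul_self_sqrt (by positivity)
  unfold stdQuadForm stdWeight
  split_ifs
  · simp only [quadForm, mulVec_smul, smul_mulVec, dotProduct_smul, smul_dotProduct, smul_eq_mul]
    conv_lhs => rw [← h]
    ring
  · simp [quadForm]

lemma quadForm_smul {r p : Type*} [Fintype r] [Fintype p] (C : Matrix r p ℝ) (W : Matrix r r ℝ)
    (s : ℝ) (z : p → ℝ) : quadForm C (s • W) z = s * quadForm C W z := by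
  simp [quadForm, smul_mulVec, dotProduct_smul]

lemma continuous_formVar {r p : Type*} [Fintype r] [Fintype p] [DecidableEq p]
    (C : Matrix r p ℝ) :
    Continuous fun q : Matrix r r ℝ × Matrix p p ℝ => formVar C q.1 q.2 := by
  unfold formVar
  fun_prop

lemma continuous_quadForm {r p : Type*} [Fintype r] [Fintype p] (C : Matrix r p ℝ) :
    Continuous fun q : Matrix r r ℝ × (p → ℝ) => quadForm C q.1 q.2 := by
  unfold quadForm
  fun_prop

/-- Along covariance matrices whose kernels contain `ker S₀`, the standardized weights of a weight
function converge. -/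
lemma IsWeight.tendsto_stdWeight {r p : Type*} [Fintype r] [Fintype p] [DecidableEq p]
    {C : Matrix r p ℝ} {W : Matrix p p ℝ → Matrix r r ℝ} {S₀ : Matrix p p ℝ} (hW : IsWeight W S₀)
    (hv : 0 < formVar C (W S₀) S₀) {T : ℕ → Matrix p p ℝ} (hT : ∀ m, (T m).PosSemidef)
    (hker : ∀ m v, S₀ *ᵥ v = 0 → T m *ᵥ v = 0) (hlim : Tendsto T atTop (𝓝 S₀)) :
    Tendsto (fun m => stdWeight C (W (T m)) (T m)) atTop
      (𝓝 ((√(formVar C (W S₀) S₀))⁻¹ • W S₀)) := by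
  have hT' : Tendsto T atTop (𝓝[{S | S.PosSemidef ∧ ∀ v, S₀ *ᵥ v = 0 → S *ᵥ v = 0}] S₀) :=
    tendsto_nhdsWithin_iff.2 ⟨hlim, .of_forall fun m => ⟨hT m, hker m⟩⟩
  have hWT : Tendsto (fun m => W (T m)) atTop (𝓝 (W S₀)) :=
    Tendsto.comp hW.continuousWithinAt hT'
  have hvT : Tendsto (fun m => formVar C (W (T m)) (T m)) atTop (𝓝 (formVar C (W S₀) S₀)) := by
    have := ((continuous_formVar C).tendsto (W S₀, S₀)).comp (hWT.prodMk_nhds hlim)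
    exact this
  have hs : Tendsto (fun m => (√(formVar C (W (T m)) (T m)))⁻¹) atTop
      (𝓝 (√(formVar C (W S₀) S₀))⁻¹) :=
    ((Real.continuous_sqrt.tendsto _).comp hvT).inv₀ (Real.sqrt_pos.2 hv).ne'
  -- the variances are eventually positive, so the case distinction in `stdWeight` disappears
  have h2 : Tendsto (fun m => (√(formVar C (W (T m)) (T m)))⁻¹ • W (T m)) atTop
      (𝓝 ((√(formVar C (W S₀) S₀))⁻¹ • W S₀)) := hs.smul hWT
  have h3 : ∀ᶠ m in atTop, 0 < formVar C (W (T m)) (T m) := hvT.eventually (lt_mem_nhds hv)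
  refine Tendsto.congr' ?_ h2
  filter_upwards [h3] with m hm
  simp only [stdWeight, if_pos hm]

lemma measurable_mul_entry {D q r p : Type*} [MeasurableSpace D] [Fintype r]
    {A : D → Matrix q r ℝ} {B : D → Matrix r p ℝ} (hA : ∀ s t, Measurable fun x => A x s t)
    (hB : ∀ s t, Measurable fun x => B x s t) (s : q) (t : p) :
    Measurable fun x => (A x * B x) s t := by
  simp only [Matrix.mul_apply]
  exact Finset.measurable_sum _ fun u _ => (hA s u).mul (hB u t)

lemma IsWeight.measurable_stdWeight {r p : Type*} [Fintype r] [Fintype p] [DecidableEq p]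
    {C : Matrix r p ℝ} {W : Matrix p p ℝ → Matrix r r ℝ} {S₀ : Matrix p p ℝ} (hW : IsWeight W S₀)
    {D : Type*} [MeasurableSpace D] {T : D → Matrix p p ℝ} (hT : ∀ s t, Measurable fun x => T x s t)
    (s t : r) : Measurable fun x => stdWeight C (W (T x)) (T x) s t := by
  have hT' : Measurable (fun x => fun s t => T x s t : D → p → p → ℝ) :=
    measurable_pi_lambda _ fun s => measurable_pi_lambda _ fun t => hT s t
  have hWT : ∀ s t, Measurable fun x => W (T x) s t := fun s t =>
    (hW.measurable_entry s t).comp hT'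
  have hf : Measurable fun x => formVar C (W (T x)) (T x) := by
    have hA : ∀ u v, Measurable fun x => (Cᵀ * W (T x) * C * T x) u v :=
      measurable_mul_entry (measurable_mul_entry (measurable_mul_entry
        (fun _ _ => measurable_const) hWT) fun _ _ => measurable_const) hT
    simp only [formVar, pow_two]
    exact (Finset.measurable_sum _ fun u _ => measurable_mul_entry hA hA u u).const_mul 2
  have : (fun x => stdWeight C (W (T x)) (T x) s t) = fun x =>
      if 0 < formVar C (W (T x)) (T x) then (√(formVar C (W (T x)) (T x)))⁻¹ * W (T x) s t
        else 0 := by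
    ext x
    by_cases h : 0 < formVar C (W (T x)) (T x)
    · simp only [stdWeight, if_pos h, Matrix.smul_apply, smul_eq_mul]
    · simp only [stdWeight, if_neg h, Matrix.zero_apply]
  rw [this]
  exact Measurable.ite (measurableSet_lt measurable_const hf) (hf.sqrt.inv.mul (hWT s t))
    measurable_const

/-- If `K = Cᵀ W C` is positive semidefinite and `K S` has a nonzero eigenvalue, then
`tr((K S)²) > 0`: this trace is the squared Frobenius norm of the symmetric matrix
`S^(1/2) K S^(1/2)`, which has the same nonzero eigenvalues as `K S`. -/
lemma formVar_pos {r p : Type*} [Fintype r] [Fintype p] [DecidableEq p] {C : Matrix r p ℝ}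
    {W : Matrix r r ℝ} {S : Matrix p p ℝ} (hW : W.PosSemidef) (hS : S.PosSemidef) {t : ℝ}
    (ht : t ≠ 0) (h : Module.End.HasEigenvalue (Matrix.toLin' (Cᵀ * W * C * S)) t) :
    0 < formVar C W S := by
  obtain ⟨R, rfl⟩ : ∃ R : Matrix p p ℝ, S = Rᵀ * R := by
    refine ⟨psdSqrt S, ?_⟩
    rw [transpose_psdSqrt, psdSqrt_mul_psdSqrt hS]
  set K := Cᵀ * W * C with hK
  have hKt : Kᵀ = K := by
    have : Wᵀ = W := by
      simpa [conjTranspose_eq_transpose_of_trivial] using hW.isHermitian.eq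
    simp [hK, this, Matrix.mul_assoc]
  set H := R * K * Rᵀ with hH
  have hHt : Hᵀ = H := by simp [hH, hKt, Matrix.mul_assoc]
  have htr : ((K * (Rᵀ * R)) ^ 2).trace = (Hᵀ * H).trace := by
    rw [hHt, pow_two, hH, show K * (Rᵀ * R) * (K * (Rᵀ * R)) =
      (K * Rᵀ * R * K * Rᵀ) * R by simp only [Matrix.mul_assoc], Matrix.trace_mul_comm]
    simp only [Matrix.mul_assoc]
  have hsum : (Hᵀ * H).trace = ∑ i, ∑ j, H j i ^ 2 := by
    simp [Matrix.trace, Matrix.mul_apply, pow_two]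
  have hnn : 0 ≤ (Hᵀ * H).trace := by
    rw [hsum]; positivity
  rw [formVar, htr]
  refine mul_pos two_pos (lt_of_le_of_ne hnn fun h0 => ?_)
  have hH0 : H = 0 := by
    rw [hsum, eq_comm, Finset.sum_eq_zero_iff_of_nonneg fun i _ => by positivity] at h0
    ext j i
    have := h0 i (Finset.mem_univ i)
    rw [Finset.sum_eq_zero_iff_of_nonneg fun j _ => by positivity] at this
    simpa using this j (Finset.mem_univ j)
  obtain ⟨v, hv⟩ := h.exists_hasEigenvector
  have hv1 : (K * (Rᵀ * R)) *ᵥ v = t • v := by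
    simpa using hv.apply_eq_smul
  have h1 : R *ᵥ v = 0 := by
    have : H *ᵥ (R *ᵥ v) = t • (R *ᵥ v) := by
      rw [← mulVec_smul, ← hv1, mulVec_mulVec, mulVec_mulVec, hH]
      simp only [Matrix.mul_assoc]
    rw [hH0, zero_mulVec] at this
    exact (smul_eq_zero.1 this.symm).resolve_left ht
  have h2 : t • v = 0 := by
    rw [← hv1, ← Matrix.mul_assoc, ← mulVec_mulVec, h1, mulVec_zero]
  exact hv.2 ((smul_eq_zero.1 h2).resolve_left ht)

/-! ### A weak law of large numbers for products -/

/-- Truncating a product at level `c` changes it by at most the excesses over `c` of the squares of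
its factors, since `|u v| ≤ max (u²) (v²)`. -/
lemma abs_sub_clip_le {u v c : ℝ} (hc : 0 ≤ c) :
    |u * v - max (-c) (min c (u * v))| ≤ max (u ^ 2 - c) 0 + max (v ^ 2 - c) 0 := by
  have h1 := le_max_left (u ^ 2 - c) 0
  have h2 := le_max_right (u ^ 2 - c) 0
  have h3 := le_max_left (v ^ 2 - c) 0
  have h4 := le_max_right (v ^ 2 - c) 0
  have h5 : |u * v| ≤ max (u ^ 2) (v ^ 2) := by
    rw [abs_le]
    rcases le_total (u ^ 2) (v ^ 2) with h | h
    · rw [max_eq_right h]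
      constructor <;> nlinarith [sq_nonneg (u - v), sq_nonneg (u + v)]
    · rw [max_eq_left h]
      constructor <;> nlinarith [sq_nonneg (u - v), sq_nonneg (u + v)]
  have h6 : max (u ^ 2) (v ^ 2) ≤ c + (max (u ^ 2 - c) 0 + max (v ^ 2 - c) 0) :=
    max_le (by linarith) (by linarith)
  obtain ⟨h7, h8⟩ := abs_le.1 (h5.trans h6)
  rcases le_total c (u * v) with h | h
  · rw [min_eq_left h, max_eq_right (by linarith), abs_le]
    constructor <;> linarith
  · rw [min_eq_right h]
    rcases le_total (-c) (u * v) with h' | h'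
    · rw [max_eq_right h', sub_self, abs_zero]
      linarith
    · rw [max_eq_left h', abs_le]
      constructor <;> linarith

lemma tendsto_integral_max_sub {Ω : Type*} [MeasurableSpace Ω] {P : Measure Ω} {f : Ω → ℝ}
    (hf : Integrable f P) (h0 : ∀ ω, 0 ≤ f ω) :
    Tendsto (fun c : ℕ => ∫ ω, max (f ω - c) 0 ∂P) atTop (𝓝 0) := by
  suffices h : Tendsto (fun c : ℕ => ∫ ω, max (f ω - c) 0 ∂P) atTop (𝓝 (∫ _, (0 : ℝ) ∂P)) by
    simpa using h
  refine tendsto_integral_of_dominated_convergence f (fun c => ?_) hf (fun c => ?_) ?_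
  · exact ((hf.1.sub aestronglyMeasurable_const).sup aestronglyMeasurable_const)
  · refine .of_forall fun ω => ?_
    rw [Real.norm_eq_abs, abs_of_nonneg (le_max_right _ _)]
    exact max_le (by linarith [Nat.cast_nonneg (α := ℝ) c]) (h0 ω)
  · refine .of_forall fun ω => tendsto_const_nhds.congr' ?_
    filter_upwards [eventually_ge_atTop ⌈f ω⌉₊] with c hc
    have : f ω ≤ c := Nat.ceil_le.1 hc
    rw [max_eq_right (by linarith)]

/-- **Weak law of large numbers in `L¹`** for products `U k * V k` of square integrable variables.
The products need not be identically distributed, only their factors: truncating the products at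
level `c` costs at most `E (U² - c)⁺ + E (V² - c)⁺`, whatever the index, and the truncated
variables have bounded variance. -/
lemma tendsto_integral_abs_average_mul_sub {Ω : Type*} [MeasurableSpace Ω] {P : Measure Ω}
    [IsProbabilityMeasure P] {U V : ℕ → Ω → ℝ} (hU : ∀ k, MemLp (U k) 2 P)
    (hV : ∀ k, MemLp (V k) 2 P) (hUid : ∀ k, IdentDistrib (U k) (U 0) P P)
    (hVid : ∀ k, IdentDistrib (V k) (V 0) P P)
    (hind : Pairwise fun k k' => IndepFun (fun ω => U k ω * V k ω) (fun ω => U k' ω * V k' ω) P)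
    {s : ℝ} (hs : ∀ k, ∫ ω, U k ω * V k ω ∂P = s) :
    Tendsto (fun n : ℕ => ∫ ω, |(n : ℝ)⁻¹ * ∑ k ∈ Finset.range n, U k ω * V k ω - s| ∂P) atTop
      (𝓝 0) := by
  have hY : ∀ k, Integrable (fun ω => U k ω * V k ω) P := fun k => (hU k).integrable_mul (hV k)
  have htr := (tendsto_integral_max_sub (hU 0).integrable_sq fun ω => sq_nonneg _).add
    (tendsto_integral_max_sub (hV 0).integrable_sq fun ω => sq_nonneg _)
  rw [add_zero] at htr
  rw [Metric.tendsto_atTop]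
  intro η hη
  obtain ⟨c, hc⟩ := ((tendsto_order.1 htr).2 (η / 4) (by positivity)).exists
  set t := ∫ ω, max (U 0 ω ^ 2 - c) 0 ∂P + ∫ ω, max (V 0 ω ^ 2 - c) 0 ∂P
  have hc0 : (0 : ℝ) ≤ c := Nat.cast_nonneg c
  let clip : ℝ → ℝ := fun y => max (-(c : ℝ)) (min c y)
  have hclip : Measurable clip := by fun_prop
  have hclip_abs : ∀ y, |clip y| ≤ c := fun y =>
    abs_le.2 ⟨le_max_left _ _, max_le (by linarith) (min_le_left _ _)⟩
  let Z : ℕ → Ω → ℝ := fun k ω => clip (U k ω * V k ω)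
  have hZm : ∀ k, AEStronglyMeasurable (Z k) P := fun k =>
    (hclip.comp_aemeasurable (hY k).1.aemeasurable).aestronglyMeasurable
  have hZ2 : ∀ k, MemLp (Z k) 2 P := fun k =>
    MemLp.of_bound (hZm k) c (.of_forall fun ω => hclip_abs _)
  have hZi : ∀ k, Integrable (Z k) P := fun k => (hZ2 k).integrable (by norm_num)
  -- the cost of the truncation
  have hdi : ∀ {F : ℕ → Ω → ℝ}, (∀ k, MemLp (F k) 2 P) → ∀ k,
      Integrable (fun ω => max (F k ω ^ 2 - c) 0) P := fun hF k =>
    ((hF k).integrable_sq.sub (integrable_const _)).sup (integrable_const _)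
  have hid : ∀ {F : ℕ → Ω → ℝ}, (∀ k, IdentDistrib (F k) (F 0) P P) → ∀ k,
      ∫ ω, max (F k ω ^ 2 - c) 0 ∂P = ∫ ω, max (F 0 ω ^ 2 - c) 0 ∂P := fun hF k =>
    ((hF k).comp (u := fun y : ℝ => max (y ^ 2 - (c : ℝ)) 0) (by fun_prop)).integral_eq
  have hYZ : ∀ k, ∫ ω, |U k ω * V k ω - Z k ω| ∂P ≤ t := by
    intro k
    calc ∫ ω, |U k ω * V k ω - Z k ω| ∂P
        ≤ ∫ ω, (max (U k ω ^ 2 - c) 0 + max (V k ω ^ 2 - c) 0) ∂P :=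
          integral_mono ((hY k).sub (hZi k)).abs ((hdi hU k).add (hdi hV k))
            fun ω => abs_sub_clip_le hc0
      _ = t := by rw [integral_add (hdi hU k) (hdi hV k), hid hUid, hid hVid]
  have hEZ : ∀ k, |P[Z k] - s| ≤ t := by
    intro k
    rw [abs_sub_comm, ← hs k, ← integral_sub (hY k) (hZi k)]
    exact (abs_integral_le_integral_abs).trans (hYZ k)
  have hvar : ∀ k, Var[Z k; P] ≤ (c : ℝ) ^ 2 := by
    intro k
    refine (variance_le_expectation_sq (hZm k)).trans ?_
    have : ∫ ω, (Z k ^ 2) ω ∂P ≤ ∫ _, (c : ℝ) ^ 2 ∂P :=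
      integral_mono (hZ2 k).integrable_sq (integrable_const _) fun ω =>
        sq_le_sq' (abs_le.1 (hclip_abs _)).1 (abs_le.1 (hclip_abs _)).2
    simpa using this
  -- for larger `n` the variance of the truncated average, at most `c² / n`, is below `η² / 4`
  obtain ⟨n₀, hn₀⟩ := exists_nat_gt (4 * (c : ℝ) ^ 2 / η ^ 2)
  refine ⟨n₀ + 1, fun n hn => ?_⟩
  have hnpos : (0 : ℝ) < n := by
    have : 0 < n := by omega
    exact_mod_cast this
  have hnn : 4 * (c : ℝ) ^ 2 / η ^ 2 < n := hn₀.trans_le (by exact_mod_cast (by omega : n₀ ≤ n))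
  have hn1 : (n : ℝ)⁻¹ * n = 1 := inv_mul_cancel₀ hnpos.ne'
  rw [Real.dist_eq, sub_zero, abs_of_nonneg (integral_nonneg fun ω => abs_nonneg _)]
  let A : Ω → ℝ := ∑ k ∈ Finset.range n, Z k
  have hA2 : MemLp A 2 P := memLp_finsetSum' _ fun k _ => hZ2 k
  have hVA : Var[A; P] ≤ n * (c : ℝ) ^ 2 := by
    rw [IndepFun.variance_sum (fun k _ => hZ2 k) fun k _ k' _ hkk' =>
      (hind hkk').comp hclip hclip]
    calc ∑ k ∈ Finset.range n, Var[Z k; P] ≤ ∑ k ∈ Finset.range n, (c : ℝ) ^ 2 :=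
          Finset.sum_le_sum fun k _ => hvar k
      _ = n * (c : ℝ) ^ 2 := by simp
  have hEA : P[A] = ∑ k ∈ Finset.range n, P[Z k] := by
    simp only [A, Finset.sum_apply]
    exact integral_finsetSum _ fun k _ => hZi k
  have hEA' : |(n : ℝ)⁻¹ * P[A] - s| ≤ t := by
    have : (n : ℝ)⁻¹ * P[A] - s = (n : ℝ)⁻¹ * ∑ k ∈ Finset.range n, (P[Z k] - s) := by
      rw [hEA, Finset.sum_sub_distrib, mul_sub]
      simp [← mul_assoc, hn1]
    rw [this, abs_mul, abs_of_pos (inv_pos.2 hnpos)]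
    calc (n : ℝ)⁻¹ * |∑ k ∈ Finset.range n, (P[Z k] - s)|
        ≤ (n : ℝ)⁻¹ * ∑ k ∈ Finset.range n, t := by
          gcongr
          exact (Finset.abs_sum_le_sum_abs _ _).trans (Finset.sum_le_sum fun k _ => hEZ k)
      _ = t := by simp [← mul_assoc, hn1]
  -- `|w| ≤ η / 4 + w² / η` handles the fluctuation of the truncated average
  have hpt : ∀ ω, |(n : ℝ)⁻¹ * ∑ k ∈ Finset.range n, U k ω * V k ω - s| ≤
      (n : ℝ)⁻¹ * ∑ k ∈ Finset.range n, |U k ω * V k ω - Z k ω| +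
        (η / 4 + η⁻¹ * ((n : ℝ)⁻¹ ^ 2 * (A ω - P[A]) ^ 2)) + t := by
    intro ω
    have h1 : (n : ℝ)⁻¹ * ∑ k ∈ Finset.range n, U k ω * V k ω - s =
        (n : ℝ)⁻¹ * ∑ k ∈ Finset.range n, (U k ω * V k ω - Z k ω) +
          (n : ℝ)⁻¹ * (A ω - P[A]) + ((n : ℝ)⁻¹ * P[A] - s) := by
      simp only [A, Finset.sum_apply, Finset.sum_sub_distrib]
      ring
    rw [h1]
    refine (abs_add_le _ _).trans (add_le_add ((abs_add_le _ _).trans (add_le_add ?_ ?_)) hEA')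
    · rw [abs_mul, abs_of_pos (inv_pos.2 hnpos)]
      gcongr
      exact Finset.abs_sum_le_sum_abs _ _
    · rw [← mul_pow]
      set w := (n : ℝ)⁻¹ * (A ω - P[A])
      have : η⁻¹ * w ^ 2 + η / 4 - |w| = η⁻¹ * (|w| - η / 2) ^ 2 := by
        rw [← sq_abs w]; field_simp; ring
      have h0 : 0 ≤ η⁻¹ * (|w| - η / 2) ^ 2 := by positivity
      linarith
  have hi1 : Integrable (fun ω => (n : ℝ)⁻¹ * ∑ k ∈ Finset.range n, |U k ω * V k ω - Z k ω|) P :=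
    (integrable_finsetSum _ fun k _ => ((hY k).sub (hZi k)).abs).const_mul _
  have hi2 : Integrable (fun ω => (A ω - P[A]) ^ 2) P :=
    (hA2.sub (memLp_const _)).integrable_sq
  have hi3 : Integrable (fun ω => η / 4 + η⁻¹ * ((n : ℝ)⁻¹ ^ 2 * (A ω - P[A]) ^ 2)) P :=
    (integrable_const _).add ((hi2.const_mul _).const_mul _)
  have hi0 : Integrable (fun ω => |(n : ℝ)⁻¹ * ∑ k ∈ Finset.range n, U k ω * V k ω - s|) P :=
    (((integrable_finsetSum _ fun k _ => hY k).const_mul _).sub (integrable_const _)).abs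
  have hint := integral_mono hi0 ((hi1.add hi3).add (integrable_const t)) hpt
  have e1 : ∫ ω, ((n : ℝ)⁻¹ * ∑ k ∈ Finset.range n, |U k ω * V k ω - Z k ω| +
        (η / 4 + η⁻¹ * ((n : ℝ)⁻¹ ^ 2 * (A ω - P[A]) ^ 2)) + t) ∂P =
      (n : ℝ)⁻¹ * ∑ k ∈ Finset.range n, ∫ ω, |U k ω * V k ω - Z k ω| ∂P +
        (η / 4 + η⁻¹ * ((n : ℝ)⁻¹ ^ 2 * Var[A; P])) + t := by
    have hid1 : ∀ k, Integrable (fun ω => |U k ω * V k ω - Z k ω|) P := fun k =>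
      ((hY k).sub (hZi k)).abs
    have hi13 : Integrable (fun ω =>
        (n : ℝ)⁻¹ * ∑ k ∈ Finset.range n, |U k ω * V k ω - Z k ω| +
          (η / 4 + η⁻¹ * ((n : ℝ)⁻¹ ^ 2 * (A ω - P[A]) ^ 2))) P := hi1.add hi3
    rw [integral_add hi13 (integrable_const t), integral_add hi1 hi3, integral_const_mul,
      integral_finsetSum _ fun k _ => hid1 k,
      integral_add (integrable_const _) ((hi2.const_mul _).const_mul _), integral_const_mul,
      integral_const_mul, variance_eq_integral hA2.aemeasurable]
    simp
  have e2 : (n : ℝ)⁻¹ * ∑ k ∈ Finset.range n, ∫ ω, |U k ω * V k ω - Z k ω| ∂P ≤ t := by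
    calc (n : ℝ)⁻¹ * ∑ k ∈ Finset.range n, ∫ ω, |U k ω * V k ω - Z k ω| ∂P
        ≤ (n : ℝ)⁻¹ * ∑ k ∈ Finset.range n, t := by
          gcongr
          exact hYZ _
      _ = t := by simp [← mul_assoc, hn1]
  have e3 : η⁻¹ * ((n : ℝ)⁻¹ ^ 2 * Var[A; P]) < η / 4 := by
    calc η⁻¹ * ((n : ℝ)⁻¹ ^ 2 * Var[A; P]) ≤ η⁻¹ * ((n : ℝ)⁻¹ ^ 2 * (n * (c : ℝ) ^ 2)) := by
          gcongr
      _ = η⁻¹ * ((c : ℝ) ^ 2 / n) := by field_simp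
      _ < η / 4 := by
          rw [div_lt_iff₀ (by positivity)] at hnn
          rw [inv_mul_lt_iff₀ hη, div_lt_iff₀ hnpos]
          nlinarith
  have hint' := hint.trans_eq e1
  linarith

/-! ### Consistency of the empirical covariance matrices of the data -/

lemma groupCov_mulVec_eq_zero {a d : ℕ} {n : Fin a → ℕ} (x : Sample n d) (i : Fin a)
    (c : EuclideanSpace ℝ (Fin d)) (v : Fin d → ℝ) (hv : ∀ k, ∑ j, v j * (x i k j - c j) = 0) :
    groupCov x i *ᵥ v = 0 := by
  rw [groupCov_eq_smul, smul_mulVec, ← mulVec_mulVec]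
  have : (Matrix.of fun (k : Fin (n i)) j => x i k j - groupMean x i j) *ᵥ v = 0 := by
    ext k
    have h0 : (n i : ℝ) ≠ 0 := by
      have := k.pos
      positivity
    have hx : ∀ k, ∑ j, v j * x i k j = ∑ j, v j * c j := by
      intro k
      have := hv k
      simp only [mul_sub, Finset.sum_sub_distrib] at this
      linarith
    have hm : ∑ j, v j * groupMean x i j = ∑ j, v j * c j := by
      calc ∑ j, v j * groupMean x i j = (n i : ℝ)⁻¹ * ∑ k, ∑ j, v j * x i k j := by
            simp only [groupMean, PiLp.smul_apply, WithLp.ofLp_sum, Finset.sum_apply, smul_eq_mul,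
              Finset.mul_sum]
            rw [Finset.sum_comm]
            exact Finset.sum_congr rfl fun _ _ => Finset.sum_congr rfl fun _ _ => by ring
        _ = ∑ j, v j * c j := by simp [hx, h0]
    calc ∑ j, (x i k j - groupMean x i j) * v j
        = ∑ j, v j * x i k j - ∑ j, v j * groupMean x i j := by
          rw [← Finset.sum_sub_distrib]
          exact Finset.sum_congr rfl fun _ _ => by ring
      _ = 0 := by rw [hx, hm, sub_self]
  rw [this]
  simp

section Data

variable {Ω : Type*} [MeasurableSpace Ω] {P : Measure Ω} [IsProbabilityMeasure P] {d : ℕ}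

lemma integral_mul_eq_covariance {ξ : Ω → EuclideanSpace ℝ (Fin d)}
    (hmean : ∀ j, ∫ ω, ξ ω j ∂P = 0) (hL2 : ∀ j, MemLp (fun ω => ξ ω j) 2 P) (j j' : Fin d) :
    ∫ ω, ξ ω j * ξ ω j' ∂P = cov[fun ω => ξ ω j, fun ω => ξ ω j'; P] := by
  rw [covariance_eq_sub (hL2 j) (hL2 j'), hmean, hmean]
  simp

lemma integral_sum_mul_sq {ξ : Ω → EuclideanSpace ℝ (Fin d)} {S : Matrix (Fin d) (Fin d) ℝ}
    (hmean : ∀ j, ∫ ω, ξ ω j ∂P = 0) (hL2 : ∀ j, MemLp (fun ω => ξ ω j) 2 P)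
    (hcov : ∀ j j', cov[fun ω => ξ ω j, fun ω => ξ ω j'; P] = S j j') (v : Fin d → ℝ) :
    ∫ ω, (∑ j, v j * ξ ω j) ^ 2 ∂P = v ⬝ᵥ (S *ᵥ v) := by
  have hi : ∀ j j', Integrable (fun ω => v j * ξ ω j * (v j' * ξ ω j')) P := fun j j' =>
    ((hL2 j).const_mul (v j)).integrable_mul ((hL2 j').const_mul (v j'))
  simp only [pow_two, Finset.sum_mul_sum]
  rw [integral_finsetSum _ fun j _ => integrable_finsetSum _ fun j' _ => hi j j']
  simp only [dotProduct, mulVec, Finset.mul_sum]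
  refine Finset.sum_congr rfl fun j _ => ?_
  rw [integral_finsetSum _ fun j' _ => hi j j']
  refine Finset.sum_congr rfl fun j' _ => ?_
  rw [← hcov, ← integral_mul_eq_covariance hmean hL2, ← integral_mul_const, ← integral_const_mul]
  congr 1
  ext ω
  ring

lemma covMatrix_posSemidef {ξ : Ω → EuclideanSpace ℝ (Fin d)} {S : Matrix (Fin d) (Fin d) ℝ}
    (hmean : ∀ j, ∫ ω, ξ ω j ∂P = 0) (hL2 : ∀ j, MemLp (fun ω => ξ ω j) 2 P)
    (hcov : ∀ j j', cov[fun ω => ξ ω j, fun ω => ξ ω j'; P] = S j j') : S.PosSemidef := by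
  refine PosSemidef.of_dotProduct_mulVec_nonneg ?_ fun v => ?_
  · ext j j'
    simp [← hcov, covariance_comm]
  · rw [star_trivial, ← integral_sum_mul_sq hmean hL2 hcov]
    exact integral_nonneg fun ω => sq_nonneg _

/-- A centred random vector is almost surely orthogonal to the kernel of its covariance matrix. -/
lemma ae_sum_mul_eq_zero {ξ : Ω → EuclideanSpace ℝ (Fin d)} {S : Matrix (Fin d) (Fin d) ℝ}
    (hmean : ∀ j, ∫ ω, ξ ω j ∂P = 0) (hL2 : ∀ j, MemLp (fun ω => ξ ω j) 2 P)
    (hcov : ∀ j j', cov[fun ω => ξ ω j, fun ω => ξ ω j'; P] = S j j') :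
    ∀ᵐ ω ∂P, ∀ v, S *ᵥ v = 0 → ∑ j, v j * ξ ω j = 0 := by
  -- a finite set spanning the kernel leaves only finitely many exceptional events
  obtain ⟨s, hs⟩ := IsNoetherian.noetherian (LinearMap.ker (Matrix.toLin' S))
  have h : ∀ᵐ ω ∂P, ∀ v ∈ s, ∑ j, v j * ξ ω j = 0 := by
    refine (ae_ball_iff s.countable_toSet).2 fun v hv => ?_
    have hv0 : S *ᵥ v = 0 := by
      have : v ∈ LinearMap.ker (Matrix.toLin' S) := hs ▸ Submodule.subset_span hv
      simpa using this
    have hL : MemLp (fun ω => ∑ j, v j * ξ ω j) 2 P :=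
      memLp_finsetSum _ fun j _ => (hL2 j).const_mul (v j)
    have h0 := integral_sum_mul_sq hmean hL2 hcov v
    rw [hv0, dotProduct_zero, integral_eq_zero_iff_of_nonneg (fun ω => sq_nonneg _)
      hL.integrable_sq] at h0
    filter_upwards [h0] with ω hω
    exact pow_eq_zero_iff two_ne_zero |>.1 hω
  filter_upwards [h] with ω hω v hv
  have hvs : v ∈ Submodule.span ℝ (s : Set (Fin d → ℝ)) := by
    rw [hs]; simpa using hv
  clear hv
  induction hvs using Submodule.span_induction with
  | mem v hv => exact hω v hv
  | zero => simp
  | add v w _ _ hv hw => simp [add_mul, Finset.sum_add_distrib, hv, hw]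
  | smul c v _ hv => simp [mul_assoc, ← Finset.mul_sum, hv]

end Data

/-- Since `N → ∞` and `nᵢ / N` has a positive limit, every group size tends to infinity. -/
lemma tendsto_groupSize {a : ℕ} {n : ℕ → Fin a → ℕ} {κ : Fin a → ℝ} (hκ : ∀ i, 0 < κ i)
    (hN : Tendsto (fun m => totalSize (n m)) atTop atTop)
    (hA1 : ∀ i, Tendsto (fun m => (n m i : ℝ) / (totalSize (n m) : ℝ)) atTop (𝓝 (κ i)))
    (i : Fin a) : Tendsto (fun m => n m i) atTop atTop := by
  have h1 : Tendsto (fun m => (totalSize (n m) : ℝ)) atTop atTop :=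
    tendsto_natCast_atTop_atTop.comp hN
  have h2 := (hA1 i).pos_mul_atTop (hκ i) h1
  refine (tendsto_natCast_atTop_iff (R := ℝ)).1 (h2.congr' ?_)
  filter_upwards [h1.eventually_gt_atTop 0] with m hm
  exact div_mul_cancel₀ _ hm.ne'

/-- Every subsequence has a further subsequence along which, almost surely, the empirical
covariance matrices converge to the true ones; moreover their kernels contain those of the true
covariance matrices. -/
lemma exists_subseq_tendsto_groupCov {Ω : Type*} [MeasurableSpace Ω] {P : Measure Ω}
    [IsProbabilityMeasure P] {a d : ℕ} (μ : Fin a → EuclideanSpace ℝ (Fin d))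
    (ε : Fin a → ℕ → Ω → EuclideanSpace ℝ (Fin d))
    (hε_indep : iIndepFun (fun p : Fin a × ℕ => ε p.1 p.2) P)
    (hε_ident : ∀ i j k k', IdentDistrib (fun ω => ε i k ω j) (fun ω => ε i k' ω j) P P)
    (hε_mean : ∀ i k j, ∫ ω, ε i k ω j ∂P = 0)
    {n : ℕ → Fin a → ℕ} (hn : ∀ i, Tendsto (fun m => n m i) atTop atTop)
    {S : Fin a → Matrix (Fin d) (Fin d) ℝ}
    (hε_memLp : ∀ i k j, MemLp (fun ω => ε i k ω j) 2 P)
    (hA2 : ∀ i k j j', covariance (fun ω => ε i k ω j) (fun ω => ε i k ω j') P = S i j j')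
    {X : (m : ℕ) → Ω → Sample (n m) d} (hX : ∀ m ω i k, X m ω i k = μ i + ε i k ω) :
    (∀ᵐ ω ∂P, ∀ m i v, S i *ᵥ v = 0 → groupCov (X m ω) i *ᵥ v = 0) ∧
    ∀ φ : ℕ → ℕ, StrictMono φ → ∃ ψ : ℕ → ℕ, StrictMono ψ ∧
      ∀ᵐ ω ∂P, ∀ i, Tendsto (fun k => groupCov (X (φ (ψ k)) ω) i) atTop (𝓝 (S i)) := by
  have hind : ∀ i {k k'}, k ≠ k' → IndepFun (ε i k) (ε i k') P := fun i k k' h =>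
    hε_indep.indepFun (i := (i, k)) (j := (i, k')) (by simpa using h)
  refine ⟨?_, fun φ hφ => ?_⟩
  · have h : ∀ᵐ ω ∂P, ∀ i k, ∀ v, S i *ᵥ v = 0 → ∑ j, v j * ε i k ω j = 0 :=
      ae_all_iff.2 fun i => ae_all_iff.2 fun k =>
        ae_sum_mul_eq_zero (hε_mean i k) (hε_memLp i k) (hA2 i k)
    filter_upwards [h] with ω hω m i v hv
    refine groupCov_mulVec_eq_zero _ i (μ i) v fun k => ?_
    simpa [hX] using hω i k v hv
  have hmean : ∀ᵐ ω ∂P, ∀ i j, Tendsto (fun n : ℕ => (n : ℝ)⁻¹ * ∑ k ∈ Finset.range n, ε i k ω j)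
      atTop (𝓝 0) := by
    refine ae_all_iff.2 fun i => ae_all_iff.2 fun j => ?_
    have := strong_law_ae_real (fun k ω => ε i k ω j) ((hε_memLp i 0 j).integrable (by norm_num))
      (fun k k' h => (hind i h).comp (φ := fun y : EuclideanSpace ℝ (Fin d) => y j)
        (ψ := fun y : EuclideanSpace ℝ (Fin d) => y j) (by fun_prop) (by fun_prop))
      (fun k => hε_ident i j k 0)
    filter_upwards [this] with ω hω
    rw [hε_mean] at hω
    exact hω.congr fun n => by rw [div_eq_inv_mul]
  -- the total deviation of the empirical second moments tends to zero in `L¹`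
  let R : ℕ → Ω → ℝ := fun m ω => ∑ q : Fin a × Fin d × Fin d,
    |(n m q.1 : ℝ)⁻¹ * ∑ k ∈ Finset.range (n m q.1), ε q.1 k ω q.2.1 * ε q.1 k ω q.2.2
      - S q.1 q.2.1 q.2.2|
  have hRi : ∀ m (q : Fin a × Fin d × Fin d), Integrable (fun ω =>
      |(n m q.1 : ℝ)⁻¹ * ∑ k ∈ Finset.range (n m q.1), ε q.1 k ω q.2.1 * ε q.1 k ω q.2.2
        - S q.1 q.2.1 q.2.2|) P := fun m q =>
    (((integrable_finsetSum _ fun k _ => (hε_memLp q.1 k q.2.1).integrable_mul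
      (hε_memLp q.1 k q.2.2)).const_mul _).sub (integrable_const _)).abs
  have hRi' : ∀ m, Integrable (R m) P := fun m => integrable_finsetSum _ fun q _ => hRi m q
  have hR0 : ∀ m ω, 0 ≤ R m ω := fun m ω => Finset.sum_nonneg fun q _ => abs_nonneg _
  have hR : Tendsto (fun m => ∫ ω, R m ω ∂P) atTop (𝓝 0) := by
    have : ∀ m, ∫ ω, R m ω ∂P = ∑ q : Fin a × Fin d × Fin d, ∫ ω,
        |(n m q.1 : ℝ)⁻¹ * ∑ k ∈ Finset.range (n m q.1), ε q.1 k ω q.2.1 * ε q.1 k ω q.2.2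
          - S q.1 q.2.1 q.2.2| ∂P := fun m => integral_finsetSum _ fun q _ => hRi m q
    simp only [this]
    rw [← Finset.sum_const_zero (s := (Finset.univ : Finset (Fin a × Fin d × Fin d)))]
    refine tendsto_finsetSum _ fun q _ => ?_
    obtain ⟨i, j, j'⟩ := q
    have := tendsto_integral_abs_average_mul_sub (U := fun k ω => ε i k ω j)
      (V := fun k ω => ε i k ω j') (fun k => hε_memLp i k j) (fun k => hε_memLp i k j')
      (fun k => hε_ident i j k 0) (fun k => hε_ident i j' k 0)
      (fun k k' h => (hind i h).comp (φ := fun y : EuclideanSpace ℝ (Fin d) => y j * y j')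
        (ψ := fun y : EuclideanSpace ℝ (Fin d) => y j * y j') (by fun_prop) (by fun_prop))
      (s := S i j j')
      (fun k => by rw [integral_mul_eq_covariance (hε_mean i k) (hε_memLp i k), hA2])
    exact this.comp (hn i)
  have hRm : TendstoInMeasure P R atTop (fun _ => 0) := by
    refine tendstoInMeasure_of_tendsto_eLpNorm one_ne_zero (fun m => (hRi' m).1)
      aestronglyMeasurable_const ?_
    have : ∀ m, eLpNorm (R m - fun _ => 0) 1 P = ENNReal.ofReal (∫ ω, R m ω ∂P) := by
      intro m
      rw [eLpNorm_one_eq_lintegral_enorm, ofReal_integral_eq_lintegral_ofReal (hRi' m)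
        (.of_forall (hR0 m))]
      refine lintegral_congr fun ω => ?_
      simp [Real.enorm_eq_ofReal (hR0 m ω)]
    simp only [this]
    simpa using ENNReal.tendsto_ofReal hR
  obtain ⟨ψ, hψ, hlim⟩ := (hRm.comp hφ.tendsto_atTop).exists_seq_tendsto_ae
  refine ⟨ψ, hψ, ?_⟩
  have hφψ : Tendsto (fun k => φ (ψ k)) atTop atTop := hφ.tendsto_atTop.comp hψ.tendsto_atTop
  filter_upwards [hmean, hlim] with ω hω1 hω2 i
  refine tendsto_groupCov (n := fun k => n (φ (ψ k))) (fun k => X (φ (ψ k)) ω) i (μ i)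
    (fun k => ε i k ω) (fun m k => hX _ ω i k) ((hn i).comp hφψ) (S i)
    (fun j => (hω1 i j).comp ((hn i).comp hφψ)) fun j j' => ?_
  rw [tendsto_iff_norm_sub_tendsto_zero]
  refine squeeze_zero (fun _ => norm_nonneg _) (fun k => ?_) hω2
  exact Finset.single_le_sum (f := fun q : Fin a × Fin d × Fin d =>
    |(n (φ (ψ k)) q.1 : ℝ)⁻¹ * ∑ l ∈ Finset.range (n (φ (ψ k)) q.1),
      ε q.1 l ω q.2.1 * ε q.1 l ω q.2.2 - S q.1 q.2.1 q.2.2|)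
    (fun q _ => abs_nonneg _) (Finset.mem_univ (i, j, j'))

/-! ### The Gaussian coupling -/

/-- The conditional law of a parametric bootstrap sample when the empirical covariance matrices
of the data are `A i`: independent vectors, with law `N(0, A i)` in group `i`. -/
def bootLaw {a d : ℕ} (n : Fin a → ℕ) (A : Fin a → Matrix (Fin d) (Fin d) ℝ) :
    Measure (Sample n d) :=
  Measure.pi fun i => Measure.pi fun _ : Fin (n i) => multivariateGaussian 0 (A i)

instance {a d : ℕ} (n : Fin a → ℕ) (A : Fin a → Matrix (Fin d) (Fin d) ℝ) :
    IsProbabilityMeasure (bootLaw n A) := by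
  unfold bootLaw; infer_instance

/-- The law of `a` independent infinite sequences of independent standard Gaussian vectors. -/
def noise (a d : ℕ) : Measure (Fin a → ℕ → EuclideanSpace ℝ (Fin d)) :=
  Measure.pi fun _ => Measure.infinitePi fun _ => stdGaussian (EuclideanSpace ℝ (Fin d))

instance (a d : ℕ) : IsProbabilityMeasure (noise a d) := by
  unfold noise; infer_instance

/-- The sample with entries `A_i^(1/2) G_{ik}` built from a Gaussian noise `G`. On the space of `G`
it realizes the laws `bootLaw n A` of all sample sizes and covariance matrices at once. -/
def coupled {a d : ℕ} (n : Fin a → ℕ) (A : Fin a → Matrix (Fin d) (Fin d) ℝ)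
    (G : Fin a → ℕ → EuclideanSpace ℝ (Fin d)) : Sample n d :=
  fun i k => toEuclideanCLM (𝕜 := ℝ) (psdSqrt (A i)) (G i k)

lemma measurable_coupled {a d : ℕ} (n : Fin a → ℕ) (A : Fin a → Matrix (Fin d) (Fin d) ℝ) :
    Measurable (coupled n A) := by
  unfold coupled
  fun_prop

lemma map_coupled {a d : ℕ} (n : Fin a → ℕ) (A : Fin a → Matrix (Fin d) (Fin d) ℝ) :
    (noise a d).map (coupled n A) = bootLaw n A := by
  have hrow : ∀ i, (Measure.infinitePi fun _ : ℕ => stdGaussian (EuclideanSpace ℝ (Fin d))).map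
      (fun (G : ℕ → EuclideanSpace ℝ (Fin d)) (k : Fin (n i)) =>
        toEuclideanCLM (𝕜 := ℝ) (psdSqrt (A i)) (G k)) =
      Measure.pi fun _ : Fin (n i) => multivariateGaussian 0 (A i) := by
    intro i
    have h1 := Measure.map_infinitePi_infinitePi_of_inj
      (P := fun _ : ℕ => stdGaussian (EuclideanSpace ℝ (Fin d))) (Fin.val_injective (n := n i))
    have h2 := Measure.infinitePi_map_pi
      (μ := fun _ : Fin (n i) => stdGaussian (EuclideanSpace ℝ (Fin d)))
      (f := fun _ => toEuclideanCLM (𝕜 := ℝ) (psdSqrt (A i))) (fun _ => by fun_prop)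
    rw [← h1, Measure.map_map (by fun_prop) (by fun_prop)] at h2
    have h4 := Measure.infinitePi_eq_pi (μ := fun _ : Fin (n i) => multivariateGaussian 0 (A i))
    rw [← h4, ← map_stdGaussian_psdSqrt]
    exact h2
  have : IsProbabilityMeasure (Measure.infinitePi fun _ : ℕ =>
    stdGaussian (EuclideanSpace ℝ (Fin d))) := inferInstance
  have hm : ∀ i, AEMeasurable (fun (G : ℕ → EuclideanSpace ℝ (Fin d)) (k : Fin (n i)) =>
        toEuclideanCLM (𝕜 := ℝ) (psdSqrt (A i)) (G k))
        (Measure.infinitePi fun _ : ℕ => stdGaussian (EuclideanSpace ℝ (Fin d))) := fun i =>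
    Measurable.aemeasurable (by fun_prop)
  have : ∀ i, SigmaFinite ((Measure.infinitePi fun _ : ℕ =>
      stdGaussian (EuclideanSpace ℝ (Fin d))).map
      (fun (G : ℕ → EuclideanSpace ℝ (Fin d)) (k : Fin (n i)) =>
        toEuclideanCLM (𝕜 := ℝ) (psdSqrt (A i)) (G k))) := fun i => by
    rw [hrow]; infer_instance
  have h := Measure.pi_map_pi (μ := fun _ : Fin a => Measure.infinitePi fun _ : ℕ =>
    stdGaussian (EuclideanSpace ℝ (Fin d))) hm
  rw [bootLaw, noise]
  simp only [← hrow]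
  exact h

/-- The normalized sums `nᵢ^(-1/2) ∑_{k < nᵢ} G_{ik}` of a Gaussian noise. -/
def normSum {a d : ℕ} (n : Fin a → ℕ) (G : Fin a → ℕ → EuclideanSpace ℝ (Fin d)) :
    Fin a → EuclideanSpace ℝ (Fin d) :=
  fun i => (√(n i : ℝ))⁻¹ • ∑ k ∈ Finset.range (n i), G i k

lemma measurable_normSum {a d : ℕ} (n : Fin a → ℕ) : Measurable (normSum (d := d) n) := by
  unfold normSum
  fun_prop

/-- A normalized sum of independent standard Gaussian vectors is a standard Gaussian vector. -/
lemma map_smul_sum_stdGaussian {d : ℕ} {n : ℕ} (hn : 0 < n) :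
    (Measure.infinitePi fun _ : ℕ => stdGaussian (EuclideanSpace ℝ (Fin d))).map
      (fun G => (√(n : ℝ))⁻¹ • ∑ k ∈ Finset.range n, G k) =
      stdGaussian (EuclideanSpace ℝ (Fin d)) := by
  set Q := Measure.infinitePi fun _ : ℕ => stdGaussian (EuclideanSpace ℝ (Fin d))
  have hind : iIndepFun (fun (k : ℕ) (G : ℕ → EuclideanSpace ℝ (Fin d)) => G k) Q :=
    iIndepFun_infinitePi (X := fun _ x => x) (fun _ => measurable_id)
  have hsum := (hind.restrict (Finset.range n)).charFun_map_fun_finsetSum_eq_prod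
    (fun k _ => (measurable_pi_apply k).aemeasurable)
  have : IsProbabilityMeasure (Q.map
      (fun G => (√(n : ℝ))⁻¹ • ∑ k ∈ Finset.range n, G k)) :=
    Measure.isProbabilityMeasure_map (Measurable.aemeasurable (by fun_prop))
  refine Measure.ext_of_charFun (funext fun t => ?_)
  have hcomp : (fun G : ℕ → EuclideanSpace ℝ (Fin d) =>
      (√(n : ℝ))⁻¹ • ∑ k ∈ Finset.range n, G k) =
      (fun y => (√(n : ℝ))⁻¹ • y) ∘ fun G => ∑ k ∈ Finset.range n, G k := rfl
  rw [hcomp, ← Measure.map_map (by fun_prop) (by fun_prop), charFun_map_smul, hsum]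
  have hk : ∀ k, Q.map (fun G => G k) = stdGaussian (EuclideanSpace ℝ (Fin d)) := fun k =>
    Measure.infinitePi_map_eval _ k
  simp only [hk, Finset.prod_const, Finset.card_range, Pi.pow_apply, charFun_stdGaussian]
  rw [← Complex.exp_nat_mul, norm_smul]
  congr 1
  have h0 : (0 : ℝ) < n := by exact_mod_cast hn
  have h : (n : ℝ) * (-(‖(√(n : ℝ))⁻¹‖ * ‖t‖) ^ 2 / 2) = -‖t‖ ^ 2 / 2 := by
    rw [mul_pow, norm_inv, inv_pow, Real.norm_eq_abs, sq_abs, Real.sq_sqrt h0.le]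
    field_simp
  exact_mod_cast h

lemma map_normSum {a d : ℕ} {n : Fin a → ℕ} (hn : ∀ i, 0 < n i) :
    (noise a d).map (normSum n) =
      Measure.pi fun _ => stdGaussian (EuclideanSpace ℝ (Fin d)) := by
  have hm : ∀ i, AEMeasurable (fun (G : ℕ → EuclideanSpace ℝ (Fin d)) =>
        (√(n i : ℝ))⁻¹ • ∑ k ∈ Finset.range (n i), G k)
        (Measure.infinitePi fun _ : ℕ => stdGaussian (EuclideanSpace ℝ (Fin d))) := fun i =>
    Measurable.aemeasurable (by fun_prop)
  have : ∀ i, SigmaFinite ((Measure.infinitePi fun _ : ℕ =>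
      stdGaussian (EuclideanSpace ℝ (Fin d))).map
      (fun (G : ℕ → EuclideanSpace ℝ (Fin d)) =>
        (√(n i : ℝ))⁻¹ • ∑ k ∈ Finset.range (n i), G k)) := fun i => by
    rw [map_smul_sum_stdGaussian (hn i)]; infer_instance
  have h := Measure.pi_map_pi (μ := fun _ : Fin a => Measure.infinitePi fun _ : ℕ =>
    stdGaussian (EuclideanSpace ℝ (Fin d))) hm
  simp only [map_smul_sum_stdGaussian (hn _)] at h
  exact h

lemma smul_meanVec_coupled {a d : ℕ} {n : Fin a → ℕ} (hn : ∀ i, 0 < n i)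
    (A : Fin a → Matrix (Fin d) (Fin d) ℝ) (G : Fin a → ℕ → EuclideanSpace ℝ (Fin d)) :
    √(totalSize n : ℝ) • meanVec (coupled n A G) =
      WithLp.toLp 2 fun p : Fin a × Fin d => ∑ q,
        (√((totalSize n : ℝ) / n p.1) * psdSqrt (A p.1) p.2 q) * normSum n G p.1 q := by
  ext p
  have h0 : (0 : ℝ) < n p.1 := by exact_mod_cast hn p.1
  have h1 : groupMean (coupled n A G) p.1 =
      (√(n p.1 : ℝ))⁻¹ • toEuclideanCLM (𝕜 := ℝ) (psdSqrt (A p.1)) (normSum n G p.1) := by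
    have h2 : (n p.1 : ℝ)⁻¹ = (√(n p.1 : ℝ))⁻¹ * (√(n p.1 : ℝ))⁻¹ := by
      rw [← mul_inv, Real.mul_self_sqrt h0.le]
    rw [groupMean, normSum, map_smul, map_sum, smul_smul, ← h2, Finset.sum_range]
    rfl
  simp only [PiLp.smul_apply, meanVec, h1, smul_eq_mul, ofLp_toEuclideanCLM, mulVec, dotProduct]
  rw [Real.sqrt_div (by positivity), ← mul_assoc, ← div_eq_mul_inv, Finset.mul_sum]
  exact Finset.sum_congr rfl fun q _ => by ring

/-- Scaling independent standard Gaussian vectors by `κᵢ^(-1/2) Sᵢ^(1/2)` and stacking them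
produces the law `N(0, Σ)`. -/
lemma map_pi_stdGaussian_eq {a d : ℕ} {κ : Fin a → ℝ} (hκ : ∀ i, 0 < κ i)
    {S : Fin a → Matrix (Fin d) (Fin d) ℝ} (hS : ∀ i, (S i).PosSemidef) :
    (Measure.pi fun _ : Fin a => stdGaussian (EuclideanSpace ℝ (Fin d))).map
      (fun u => WithLp.toLp 2 fun p : Fin a × Fin d => ∑ q,
        (√(κ p.1)⁻¹ * psdSqrt (S p.1) p.2 q) * u p.1 q) =
      multivariateGaussian 0 (limitCov κ S) := by
  have hmeas : Measurable (fun u : Fin a → EuclideanSpace ℝ (Fin d) =>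
      (WithLp.toLp 2 fun p : Fin a × Fin d => ∑ q,
        (√(κ p.1)⁻¹ * psdSqrt (S p.1) p.2 q) * u p.1 q : EuclideanSpace ℝ (Fin a × Fin d))) := by
    fun_prop
  have : IsProbabilityMeasure ((Measure.pi fun _ : Fin a =>
      stdGaussian (EuclideanSpace ℝ (Fin d))).map
      (fun u => (WithLp.toLp 2 fun p : Fin a × Fin d => ∑ q,
        (√(κ p.1)⁻¹ * psdSqrt (S p.1) p.2 q) * u p.1 q : EuclideanSpace ℝ (Fin a × Fin d)))) :=
    Measure.isProbabilityMeasure_map hmeas.aemeasurable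
  refine Measure.ext_of_charFun (funext fun t => ?_)
  rw [charFun_multivariateGaussian (limitCov_posSemidef hκ hS), charFun_apply,
    integral_map hmeas.aemeasurable (by fun_prop)]
  -- the dual vectors of the individual groups
  let s : Fin a → EuclideanSpace ℝ (Fin d) := fun i =>
    √(κ i)⁻¹ • WithLp.toLp 2 (psdSqrt (S i) *ᵥ fun j => t (i, j))
  have hsym : ∀ i j q, psdSqrt (S i) j q = psdSqrt (S i) q j := fun i j q => by
    conv_lhs => rw [← transpose_psdSqrt (S i), transpose_apply]
  have hinner : ∀ u : Fin a → EuclideanSpace ℝ (Fin d),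
      inner ℝ (WithLp.toLp 2 fun p : Fin a × Fin d => ∑ q,
        (√(κ p.1)⁻¹ * psdSqrt (S p.1) p.2 q) * u p.1 q : EuclideanSpace ℝ (Fin a × Fin d)) t =
      ∑ i, inner ℝ (u i) (s i) := by
    intro u
    simp only [PiLp.inner_apply, Fintype.sum_prod_type, s, PiLp.smul_apply, smul_eq_mul,
      mulVec, dotProduct, RCLike.inner_apply, conj_trivial, Finset.mul_sum, Finset.sum_mul]
    refine Finset.sum_congr rfl fun i _ => ?_
    rw [Finset.sum_comm]
    refine Finset.sum_congr rfl fun q _ => Finset.sum_congr rfl fun j _ => ?_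
    rw [hsym i j q]
    ring
  have hnorm : ∀ i, ‖s i‖ ^ 2 = (κ i)⁻¹ * ((fun j => t (i, j)) ⬝ᵥ (S i *ᵥ fun j => t (i, j))) := by
    intro i
    rw [norm_smul, mul_pow, Real.norm_eq_abs, sq_abs, Real.sq_sqrt (inv_nonneg.2 (hκ i).le)]
    congr 1
    rw [EuclideanSpace.real_norm_sq_eq]
    have : ∑ j, (psdSqrt (S i) *ᵥ fun j => t (i, j)) j ^ 2 =
        (psdSqrt (S i) *ᵥ fun j => t (i, j)) ⬝ᵥ (psdSqrt (S i) *ᵥ fun j => t (i, j)) := by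
      simp [dotProduct, pow_two]
    rw [this, dotProduct_mulVec, vecMul_mulVec, transpose_psdSqrt, psdSqrt_mul_psdSqrt (hS i),
      ← dotProduct_mulVec]
  simp_rw [hinner]
  push_cast
  simp_rw [Finset.sum_mul, Complex.exp_sum]
  rw [integral_fintype_prod_eq_prod (μ := fun _ : Fin a => stdGaussian (EuclideanSpace ℝ (Fin d)))
    (f := fun i (x : EuclideanSpace ℝ (Fin d)) =>
      Complex.exp (((inner ℝ x (s i) : ℝ) : ℂ) * Complex.I))]
  simp_rw [← charFun_apply, charFun_stdGaussian]
  rw [← Complex.exp_sum]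
  congr 1
  have h : ∑ i, -‖s i‖ ^ 2 / 2 = - ((t : Fin a × Fin d → ℝ) ⬝ᵥ (limitCov κ S *ᵥ t)) / 2 := by
    rw [limitCov, dotProduct_directSum_mulVec, ← Finset.sum_div, Finset.sum_neg_distrib]
    simp only [hnorm, smul_mulVec, dotProduct_smul, smul_eq_mul]
  have h' := congrArg (fun x : ℝ => (x : ℂ)) h
  push_cast at h'
  rw [h']
  simp
  ring

/-! ### Weak convergence along deterministic covariance matrices -/

/-- Covariance matrices `A m i → S i`, positive semidefinite and with `ker (S i) ⊆ ker (A m i)`: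
what the empirical covariance matrices of the data satisfy, almost surely, along subsequences. -/
structure IsCovSeq {a d : ℕ} (S : Fin a → Matrix (Fin d) (Fin d) ℝ)
    (A : ℕ → Fin a → Matrix (Fin d) (Fin d) ℝ) : Prop where
  posSemidef : ∀ m i, (A m i).PosSemidef
  ker : ∀ m i v, S i *ᵥ v = 0 → A m i *ᵥ v = 0
  tendsto : ∀ i, Tendsto (fun m => A m i) atTop (𝓝 (S i))

lemma memLp_eval_stdGaussian {d : ℕ} (j : Fin d) :
    MemLp (fun x : EuclideanSpace ℝ (Fin d) => x j) 2 (stdGaussian (EuclideanSpace ℝ (Fin d))) :=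
  (EuclideanSpace.proj (𝕜 := ℝ) j).comp_memLp' IsGaussian.memLp_two_id

lemma integral_eval_stdGaussian {d : ℕ} (j : Fin d) :
    ∫ x : EuclideanSpace ℝ (Fin d), x j ∂stdGaussian (EuclideanSpace ℝ (Fin d)) = 0 :=
  integral_strongDual_stdGaussian (EuclideanSpace.proj (𝕜 := ℝ) j)

lemma integral_mul_stdGaussian {d : ℕ} (j j' : Fin d) :
    ∫ x : EuclideanSpace ℝ (Fin d), x j * x j' ∂stdGaussian (EuclideanSpace ℝ (Fin d)) =
      (1 : Matrix (Fin d) (Fin d) ℝ) j j' := by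
  rw [integral_mul_eq_covariance (ξ := fun x => x) integral_eval_stdGaussian
    memLp_eval_stdGaussian, ← multivariateGaussian_zero_one,
    covariance_eval_multivariateGaussian PosSemidef.one]

/-- The strong law of large numbers for a function of the vectors of a Gaussian noise. -/
lemma noise_strong_law {a d : ℕ} (i : Fin a) {f : EuclideanSpace ℝ (Fin d) → ℝ}
    (hf : Measurable f) (hfi : Integrable f (stdGaussian (EuclideanSpace ℝ (Fin d)))) :
    ∀ᵐ G ∂noise a d, Tendsto (fun n : ℕ => (n : ℝ)⁻¹ * ∑ k ∈ Finset.range n, f (G i k)) atTop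
      (𝓝 (∫ x, f x ∂stdGaussian (EuclideanSpace ℝ (Fin d)))) := by
  set Q := Measure.infinitePi fun _ : ℕ => stdGaussian (EuclideanSpace ℝ (Fin d))
  have hpres : ∀ k, MeasurePreserving (fun G : ℕ → EuclideanSpace ℝ (Fin d) => G k) Q
      (stdGaussian (EuclideanSpace ℝ (Fin d))) := fun k => measurePreserving_eval_infinitePi _ k
  have hind : iIndepFun (fun (k : ℕ) (G : ℕ → EuclideanSpace ℝ (Fin d)) => f (G k)) Q :=
    iIndepFun_infinitePi (X := fun _ x => f x) (fun _ => hf)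
  have hid : ∀ k, IdentDistrib (fun G : ℕ → EuclideanSpace ℝ (Fin d) => f (G k))
      (fun G => f (G 0)) Q Q := fun k =>
    IdentDistrib.comp (u := f) ⟨(hpres k).aemeasurable, (hpres 0).aemeasurable, (hpres k).map_eq.trans
      (hpres 0).map_eq.symm⟩ hf
  have h := strong_law_ae_real (fun k (G : ℕ → EuclideanSpace ℝ (Fin d)) => f (G k))
    ((hpres 0).integrable_comp_of_integrable hfi) (fun k k' hk => hind.indepFun hk) hid
  have hint : ∫ G : ℕ → EuclideanSpace ℝ (Fin d), f (G 0) ∂Q =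
      ∫ x, f x ∂stdGaussian (EuclideanSpace ℝ (Fin d)) := by
    rw [← (hpres 0).map_eq, integral_map (hpres 0).aemeasurable hf.aestronglyMeasurable]
  have h' : ∀ᵐ G ∂noise a d, Tendsto (fun n : ℕ => (∑ k ∈ Finset.range n, f (G i k)) / n) atTop
      (𝓝 (∫ G : ℕ → EuclideanSpace ℝ (Fin d), f (G 0) ∂Q)) :=
    (measurePreserving_eval (fun _ : Fin a => Q) i).quasiMeasurePreserving.ae h
  filter_upwards [h'] with G hG
  rw [← hint]
  exact hG.congr fun n => by rw [div_eq_inv_mul]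

/-- In the coupling, the empirical covariance matrices of the bootstrap sample converge almost
surely. -/
lemma ae_tendsto_groupCov_coupled {a d : ℕ} {n : ℕ → Fin a → ℕ}
    (hn : ∀ i, Tendsto (fun m => n m i) atTop atTop) {S : Fin a → Matrix (Fin d) (Fin d) ℝ}
    (hS : ∀ i, (S i).PosSemidef) {A : ℕ → Fin a → Matrix (Fin d) (Fin d) ℝ} (hA : IsCovSeq S A) :
    ∀ᵐ G ∂noise a d, ∀ i,
      Tendsto (fun m => groupCov (coupled (n m) (A m) G) i) atTop (𝓝 (S i)) := by
  have h1 : ∀ᵐ G ∂noise a d, ∀ i (j : Fin d), Tendsto (fun n : ℕ => (n : ℝ)⁻¹ *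
      ∑ k ∈ Finset.range n, G i k j) atTop (𝓝 0) :=
    ae_all_iff.2 fun i => ae_all_iff.2 fun j => by
      have := noise_strong_law i (f := fun x : EuclideanSpace ℝ (Fin d) => x j) (by fun_prop)
        ((memLp_eval_stdGaussian j).integrable (by norm_num))
      rwa [integral_eval_stdGaussian] at this
  have h2 : ∀ᵐ G ∂noise a d, ∀ i (j j' : Fin d), Tendsto (fun n : ℕ => (n : ℝ)⁻¹ *
      ∑ k ∈ Finset.range n, G i k j * G i k j') atTop
      (𝓝 ((1 : Matrix (Fin d) (Fin d) ℝ) j j')) :=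
    ae_all_iff.2 fun i => ae_all_iff.2 fun j => ae_all_iff.2 fun j' => by
      have := noise_strong_law i (f := fun x : EuclideanSpace ℝ (Fin d) => x j * x j')
        (by fun_prop) ((memLp_eval_stdGaussian j).integrable_mul (memLp_eval_stdGaussian j'))
      rwa [integral_mul_stdGaussian] at this
  filter_upwards [h1, h2] with G hG1 hG2 i
  have hraw := tendsto_groupCov (n := n) (fun m i k => G i k) i 0 (G i) (by simp) (hn i) 1
    (fun j => (hG1 i j).comp (hn i)) (fun j j' => (hG2 i j j').comp (hn i))
  have hB := tendsto_psdSqrt (fun m => hA.posSemidef m i) (hS i) (hA.tendsto i)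
  have hBt : Tendsto (fun m => (psdSqrt (A m i))ᵀ) atTop (𝓝 (psdSqrt (S i))ᵀ) :=
    (Continuous.matrix_transpose continuous_id).continuousAt.tendsto.comp hB
  have hlim := (hB.mul hraw).mul hBt
  rw [Matrix.mul_one, transpose_psdSqrt, psdSqrt_mul_psdSqrt (hS i)] at hlim
  exact hlim.congr fun m =>
    (groupCov_toEuclideanCLM (n := n m) (fun i => psdSqrt (A m i)) (fun i k => G i k) i).symm

lemma groupCov_coupled_mulVec_eq_zero {a d : ℕ} {n : Fin a → ℕ}
    {A : Fin a → Matrix (Fin d) (Fin d) ℝ} (hA : ∀ i, (A i).PosSemidef)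
    (G : Fin a → ℕ → EuclideanSpace ℝ (Fin d)) (i : Fin a) {v : Fin d → ℝ} (hv : A i *ᵥ v = 0) :
    groupCov (coupled n A G) i *ᵥ v = 0 := by
  have : groupCov (coupled n A G) i =
      psdSqrt (A i) * groupCov (fun i k => G i k : Sample n d) i * (psdSqrt (A i))ᵀ :=
    groupCov_toEuclideanCLM (n := n) (fun i => psdSqrt (A i)) (fun i k => G i k) i
  rw [this, transpose_psdSqrt, ← mulVec_mulVec, psdSqrt_mulVec_eq_zero (hA i) hv, mulVec_zero]

lemma measurable_meanVec {a d : ℕ} {n : Fin a → ℕ} :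
    Measurable (meanVec : Sample n d → EuclideanSpace ℝ (Fin a × Fin d)) := by
  unfold meanVec groupMean
  fun_prop

/-- Joint limit of the rescaled mean vector and of a statistic `K` that is consistent in the
coupling. The normalized sums of the Gaussian noise have *exactly* a standard Gaussian law, so only
Slutsky's theorem is needed to replace `K` and the scaling matrices by their limits. -/
lemma tendsto_integral_bootLaw {a d : ℕ} {n : ℕ → Fin a → ℕ}
    (hn : ∀ i, Tendsto (fun m => n m i) atTop atTop) {κ : Fin a → ℝ} (hκ : ∀ i, 0 < κ i)
    (hA1 : ∀ i, Tendsto (fun m => (n m i : ℝ) / (totalSize (n m) : ℝ)) atTop (𝓝 (κ i)))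
    {S : Fin a → Matrix (Fin d) (Fin d) ℝ} (hS : ∀ i, (S i).PosSemidef)
    {A : ℕ → Fin a → Matrix (Fin d) (Fin d) ℝ} (hA : IsCovSeq S A)
    {E' F : Type*} [MeasurableSpace E'] [SeminormedAddCommGroup E'] [SecondCountableTopology E']
    [BorelSpace E'] [TopologicalSpace F] [MeasurableSpace F] [BorelSpace F]
    {g : EuclideanSpace ℝ (Fin a × Fin d) × E' → F} (hg : Continuous g)
    {K : (m : ℕ) → Sample (n m) d → E'} (hK : ∀ m, Measurable (K m)) {c : E'}
    (hKc : ∀ᵐ G ∂noise a d, Tendsto (fun m => K m (coupled (n m) (A m) G)) atTop (𝓝 c))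
    (f : BoundedContinuousFunction F ℝ) :
    Tendsto (fun m => ∫ x, f (g (√(totalSize (n m) : ℝ) • meanVec x, K m x))
      ∂bootLaw (n m) (A m)) atTop
      (𝓝 (∫ z, f (g (z, c)) ∂multivariateGaussian 0 (limitCov κ S))) := by
  -- the pair of scaling matrices and statistic, with its constant limit
  let B : ℕ → Fin a → Fin d → Fin d → ℝ := fun m i p q =>
    √((totalSize (n m) : ℝ) / n m i) * psdSqrt (A m i) p q
  let B₀ : Fin a → Fin d → Fin d → ℝ := fun i p q => √(κ i)⁻¹ * psdSqrt (S i) p q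
  have hB : Tendsto B atTop (𝓝 B₀) := by
    refine tendsto_pi_nhds.2 fun i => tendsto_pi_nhds.2 fun p => tendsto_pi_nhds.2 fun q => ?_
    have h1 : Tendsto (fun m => (totalSize (n m) : ℝ) / n m i) atTop (𝓝 (κ i)⁻¹) := by
      simpa using (hA1 i).inv₀ (hκ i).ne'
    have h2 := tendsto_psdSqrt (fun m => hA.posSemidef m i) (hS i) (hA.tendsto i)
    exact ((Real.continuous_sqrt.tendsto _).comp h1).mul
      (tendsto_pi_nhds.1 (tendsto_pi_nhds.1 h2 p) q)
  let Y : ℕ → (Fin a → ℕ → EuclideanSpace ℝ (Fin d)) → E' × (Fin a → Fin d → Fin d → ℝ) :=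
    fun m G => (K m (coupled (n m) (A m) G), B m)
  have hYm : ∀ m, Measurable (Y m) := fun m =>
    ((hK m).comp (measurable_coupled _ _)).prodMk measurable_const
  have hY : TendstoInMeasure (noise a d) Y atTop (fun _ => (c, B₀)) := by
    refine tendstoInMeasure_of_tendsto_ae (fun m => (hYm m).aestronglyMeasurable) ?_
    filter_upwards [hKc] with G hG
    exact hG.prodMk_nhds hB
  -- the exact law of the normalized sums requires every group to be nonempty
  have hpos : ∀ᶠ m in atTop, ∀ i, 0 < n m i :=
    eventually_all.2 fun i => (hn i).eventually_gt_atTop 0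
  have hU : TendstoInDistribution (fun m => normSum (d := d) (n m)) atTop
      (fun u : Fin a → EuclideanSpace ℝ (Fin d) => u) (fun _ => noise a d)
      (Measure.pi fun _ => stdGaussian (EuclideanSpace ℝ (Fin d))) := by
    refine ⟨fun m => (measurable_normSum _).aemeasurable, measurable_id.aemeasurable, ?_⟩
    refine tendsto_const_nhds.congr' ?_
    filter_upwards [hpos] with m hm
    refine Subtype.ext ?_
    simp only [map_normSum hm]
    exact Measure.map_id
  let h : (Fin a → EuclideanSpace ℝ (Fin d)) × (E' × (Fin a → Fin d → Fin d → ℝ)) → F := fun w =>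
    g (WithLp.toLp 2 fun p => ∑ q, w.2.2 p.1 p.2 q * w.1 p.1 q, w.2.1)
  have hh : Continuous h := by
    refine hg.comp (Continuous.prodMk ?_ (by fun_prop))
    refine (PiLp.continuous_toLp 2 _).comp (continuous_pi fun p => ?_)
    fun_prop
  have hdist := hU.continuous_comp_prodMk_of_tendstoInMeasure_const hh hY
    fun m => (hYm m).aemeasurable
  have hlim := (ProbabilityMeasure.tendsto_iff_forall_integral_tendsto.1 hdist.tendsto) f
  simp only [ProbabilityMeasure.coe_mk] at hlim
  have hfm : ∀ {μ : Measure F}, AEStronglyMeasurable f μ := fun {μ} =>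
    f.continuous.measurable.aestronglyMeasurable
  have hz : Measurable fun u : Fin a → EuclideanSpace ℝ (Fin d) =>
      (WithLp.toLp 2 fun p : Fin a × Fin d => ∑ q, B₀ p.1 p.2 q * u p.1 q :
        EuclideanSpace ℝ (Fin a × Fin d)) := by
    fun_prop
  have hlimit : ∫ y, f y ∂((Measure.pi fun _ : Fin a => stdGaussian (EuclideanSpace ℝ (Fin d))).map
      fun u => h (u, (c, B₀))) = ∫ z, f (g (z, c)) ∂multivariateGaussian 0 (limitCov κ S) := by
    rw [← map_pi_stdGaussian_eq hκ hS, integral_map hdist.aemeasurable_limit hfm,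
      integral_map hz.aemeasurable]
    exact (f.continuous.comp (hg.comp (by fun_prop))).measurable.aestronglyMeasurable
  rw [hlimit] at hlim
  refine hlim.congr' ?_
  filter_upwards [hpos] with m hm
  have hcont : Continuous fun w => f (g w) := f.continuous.comp hg
  have hmeas : Measurable fun x : Sample (n m) d =>
      f (g (√(totalSize (n m) : ℝ) • meanVec x, K m x)) := by
    have hmv : Measurable fun x : Sample (n m) d => √(totalSize (n m) : ℝ) • meanVec x :=
      (continuous_const_smul _).measurable.comp measurable_meanVec
    have hpair : Measurable fun x : Sample (n m) d =>
      (√(totalSize (n m) : ℝ) • meanVec x, K m x) := hmv.prodMk (hK m)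
    exact hcont.measurable.comp hpair
  rw [integral_map (hdist.forall_aemeasurable m) hfm, ← map_coupled,
    integral_map (measurable_coupled _ _).aemeasurable hmeas.aestronglyMeasurable]
  refine integral_congr_ae (.of_forall fun G => ?_)
  simp only [h, Y, B, smul_meanVec_coupled hm]

/-! ### From deterministic covariance matrices to conditional laws given the data -/

/-- A statistic of the bootstrap sample converges conditionally, in probability, if its laws
converge along every sequence of covariance matrices with the properties that the empirical
covariance matrices of the data have along subsequences. -/
lemma condTendstoWeakly_of_bootLaw {Ω : Type*} [MeasurableSpace Ω] {P : Measure Ω}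
    [IsProbabilityMeasure P] {a d : ℕ} {n : ℕ → Fin a → ℕ}
    {S : Fin a → Matrix (Fin d) (Fin d) ℝ} {X Xs : (m : ℕ) → Ω → Sample (n m) d}
    (hXm : ∀ m, Measurable (X m)) (hXs : ∀ m, IsParametricBootstrap P (X m) (Xs m))
    (hker : ∀ᵐ ω ∂P, ∀ m i v, S i *ᵥ v = 0 → groupCov (X m ω) i *ᵥ v = 0)
    (hsub : ∀ φ : ℕ → ℕ, StrictMono φ → ∃ ψ : ℕ → ℕ, StrictMono ψ ∧
      ∀ᵐ ω ∂P, ∀ i, Tendsto (fun k => groupCov (X (φ (ψ k)) ω) i) atTop (𝓝 (S i)))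
    {E : Type*} [TopologicalSpace E] [PolishSpace E] [MeasurableSpace E] [BorelSpace E]
    [Nonempty E] {T : (m : ℕ) → Sample (n m) d → E} (hT : ∀ m, Measurable (T m)) {ν : Measure E}
    (h : ∀ φ : ℕ → ℕ, StrictMono φ → ∀ A, IsCovSeq S A → ∀ f : BoundedContinuousFunction E ℝ,
      Tendsto (fun k => ∫ x, f (T (φ k) x) ∂bootLaw (n (φ k)) (A k)) atTop (𝓝 (∫ z, f z ∂ν))) :
    CondTendstoWeakly P X (fun m ω => T m (Xs m ω)) ν := by
  intro f
  have hcond : ∀ᵐ ω ∂P, ∀ m, ∫ z, f z ∂(condDistrib (fun ω => T m (Xs m ω)) (X m) P (X m ω)) =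
      ∫ x, f (T m x) ∂bootLaw (n m) (groupCov (X m ω)) := by
    refine ae_all_iff.2 fun m => ?_
    have h1 := ae_of_ae_map (hXm m).aemeasurable
      (condDistrib_comp (μ := P) (X m) (hXs m).measurable.aemeasurable (hT m))
    have h2 := ae_of_ae_map (hXm m).aemeasurable (hXs m).condLaw
    filter_upwards [h1, h2] with ω hω1 hω2
    have h3 : condDistrib (fun ω => T m (Xs m ω)) (X m) P (X m ω) =
        (bootLaw (n m) (groupCov (X m ω))).map (T m) := by
      have : condDistrib (T m ∘ Xs m) (X m) P (X m ω) = _ := hω1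
      rw [Kernel.map_apply _ (hT m), hω2] at this
      exact this
    rw [h3, integral_map (hT m).aemeasurable f.continuous.measurable.aestronglyMeasurable]
  refine (exists_seq_tendstoInMeasure_atTop_iff fun m => ?_).2 fun φ hφ => ?_
  · have hfs : StronglyMeasurable fun q : Sample (n m) d × E => f q.2 :=
      f.continuous.stronglyMeasurable.comp_measurable measurable_snd
    exact ((hfs.integral_condDistrib (Y := fun ω => T m (Xs m ω)) (X := X m)
      (μ := P)).comp_measurable (hXm m)).aestronglyMeasurable
  · obtain ⟨ψ, hψ, hlim⟩ := hsub φ hφ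
    refine ⟨ψ, hψ, ?_⟩
    filter_upwards [hcond, hker, hlim] with ω hω hkω hlω
    simp only [hω]
    exact h (φ ∘ ψ) (hφ.comp hψ) (fun k => groupCov (X (φ (ψ k)) ω))
      ⟨fun k i => groupCov_posSemidef _ i, fun k => hkω _, hlω⟩ f

/-- Conditional weak convergence in probability to a constant implies unconditional convergence
in probability. -/
lemma CondTendstoWeakly.tendstoInMeasure {Ω : Type*} [MeasurableSpace Ω] {P : Measure Ω}
    [IsProbabilityMeasure P] {D : ℕ → Type*} [∀ m, MeasurableSpace (D m)]
    {X : (m : ℕ) → Ω → D m} (hX : ∀ m, Measurable (X m)) {T : ℕ → Ω → ℝ}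
    (hT : ∀ m, Measurable (T m)) {c : ℝ} (h : CondTendstoWeakly P X T (Measure.dirac c)) :
    TendstoInMeasure P T atTop (fun _ => c) := by
  -- `E min (|T - c|, 1)` is the mean of its conditional version, which tends to zero
  let f : BoundedContinuousFunction ℝ ℝ :=
    BoundedContinuousFunction.ofNormedAddCommGroup (fun z => min |z - c| 1) (by fun_prop) 1
      (fun z => by
        rw [Real.norm_eq_abs, abs_of_nonneg (le_min (abs_nonneg _) zero_le_one)]
        exact min_le_right _ _)
  have hf : ∀ z, f z = min |z - c| 1 := fun z => rfl
  have hf0 : ∀ z, 0 ≤ f z := fun z => le_min (abs_nonneg _) zero_le_one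
  have hfi : ∀ m, Integrable (fun ω => f (T m ω)) P := fun m =>
    Integrable.of_bound (f.continuous.measurable.comp (hT m)).aestronglyMeasurable 1
      (.of_forall fun ω => by
        rw [Real.norm_eq_abs, abs_of_nonneg (hf0 _)]
        exact min_le_right _ _)
  have hfm : ∀ m, StronglyMeasurable fun q : D m × ℝ => f q.2 := fun m =>
    f.continuous.stronglyMeasurable.comp_measurable measurable_snd
  set g : ℕ → Ω → ℝ := fun m ω => ∫ z, f z ∂(condDistrib (T m) (X m) P (X m ω))
  have hgT : TendstoInMeasure P g atTop (fun _ => 0) := by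
    have := h f
    rwa [integral_dirac, show f c = 0 by simp [hf]] at this
  have hgm : ∀ m, AEStronglyMeasurable (g m) P := fun m =>
    (((hfm m).integral_condDistrib (Y := T m) (X := X m)
      (μ := P)).comp_measurable (hX m)).aestronglyMeasurable
  have hg1 : ∀ m ω, ‖g m ω‖ ≤ 1 := by
    intro m ω
    refine (norm_integral_le_of_norm_le_const (C := 1) (.of_forall fun z => ?_)).trans (by simp)
    rw [Real.norm_eq_abs, abs_of_nonneg (hf0 _)]
    exact min_le_right _ _
  have hgint : ∀ m, ∫ ω, g m ω ∂P = ∫ ω, f (T m ω) ∂P := by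
    intro m
    have h1 := condExp_ae_eq_integral_condDistrib (hX m) (hT m).aemeasurable
      f.continuous.stronglyMeasurable (hfi m)
    rw [← integral_congr_ae h1, integral_condExp (hX m).comap_le]
  have hlim : Tendsto (fun m => ∫ ω, f (T m ω) ∂P) atTop (𝓝 0) := by
    refine tendsto_of_subseq_tendsto fun ns hns => ?_
    obtain ⟨ms, -, hms⟩ := (hgT.comp hns).exists_seq_tendsto_ae
    refine ⟨ms, ?_⟩
    have := tendsto_integral_of_dominated_convergence (μ := P) (fun _ => 1)
      (fun k => hgm (ns (ms k))) (integrable_const _) (fun k => .of_forall (hg1 _)) hms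
    simpa [hgint] using this
  rw [tendstoInMeasure_iff_measureReal_norm]
  intro η hη
  have hδ : 0 < min η 1 := lt_min hη one_pos
  refine squeeze_zero (fun m => measureReal_nonneg) (fun m => ?_)
    (by simpa using hlim.const_mul (min η 1)⁻¹)
  have hle := mul_meas_ge_le_integral_of_nonneg (.of_forall fun ω => hf0 (T m ω)) (hfi m) (min η 1)
  rw [← div_eq_inv_mul, le_div_iff₀ hδ, mul_comm]
  refine le_trans (mul_le_mul_of_nonneg_left (measureReal_mono fun ω hω => ?_) hδ.le) hle
  have hω' : η ≤ ‖T m ω - c‖ := hω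
  exact min_le_min_right 1 hω'

/-! ### The bootstrap statistics -/

lemma measurable_groupCov {a d : ℕ} {n : Fin a → ℕ} (i : Fin a) (j j' : Fin d) :
    Measurable fun x : Sample n d => groupCov x i j j' := by
  have h : ∀ j, Measurable fun x : Sample n d => groupMean x i j := fun j => by
    unfold groupMean
    fun_prop
  have hc : ∀ k j, Measurable fun x : Sample n d => x i k j - groupMean x i j := fun k j =>
    Measurable.sub (by fun_prop) (h j)
  have hs : Measurable fun x : Sample n d =>
      ∑ k, (x i k j - groupMean x i j) * (x i k j' - groupMean x i j') :=
    Finset.measurable_sum _ fun k _ => (hc k j).mul (hc k j')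
  exact hs.const_mul ((n i : ℝ) - 1)⁻¹

lemma measurable_pooledCov {a d : ℕ} {n : Fin a → ℕ} (p q : Fin a × Fin d) :
    Measurable fun x : Sample n d => pooledCov x p q := by
  simp only [pooledCov_apply]
  split_ifs
  · exact (measurable_groupCov _ _ _).const_mul _
  · exact measurable_const

lemma measurable_componentCov {a d : ℕ} {n : Fin a → ℕ} (j : Fin d) (p q : Fin a) :
    Measurable fun x : Sample n d => componentCov x j p q := by
  simp only [componentCov, Matrix.smul_apply, diagonal_apply]
  split_ifs
  · exact ((measurable_groupCov _ _ _).const_mul _).const_mul _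
  · exact measurable_const

/-- The quadratic forms of `equalityForms` as a function of the rescaled mean vector and of the
standardized weight matrices. -/
def equalityMap (a d : ℕ)
    (w : EuclideanSpace ℝ (Fin a × Fin d) × (Fin d → Fin a → Fin a → ℝ)) : Fin d → ℝ :=
  fun j => quadForm (centering a) (Matrix.of (w.2 j)) fun i => w.1 (i, j)

lemma continuous_equalityMap (a d : ℕ) : Continuous (equalityMap a d) := by
  refine continuous_pi fun j => (continuous_quadForm (centering a)).comp
    (Continuous.prodMk ?_ (by fun_prop))
  exact (continuous_apply j).comp continuous_snd

lemma equalityForms_eq {a d : ℕ} {n : Fin a → ℕ}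
    (Mt : Matrix (Fin a) (Fin a) ℝ → Matrix (Fin a) (Fin a) ℝ → Matrix (Fin a) (Fin a) ℝ)
    (x : Sample n d) :
    equalityForms Mt x = equalityMap a d (√(totalSize n : ℝ) • meanVec x, fun j =>
      stdWeight (centering a) (Mt (centering a) (componentCov x j)) (componentCov x j)) := by
  ext j
  exact stdQuadForm_eq _ _ _ _ _

/-- The quadratic forms of `generalForms` as a function of the rescaled mean vector and of the
standardized weight matrices. -/
def generalMap {a d L : ℕ} {r : Fin L → ℕ} (C : (l : Fin L) → Matrix (Fin (r l)) (Fin a × Fin d) ℝ)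
    (w : EuclideanSpace ℝ (Fin a × Fin d) × ((l : Fin L) → Fin (r l) → Fin (r l) → ℝ)) :
    Fin L → ℝ :=
  fun l => quadForm (C l) (Matrix.of (w.2 l)) (WithLp.ofLp w.1)

lemma continuous_generalMap {a d L : ℕ} {r : Fin L → ℕ}
    (C : (l : Fin L) → Matrix (Fin (r l)) (Fin a × Fin d) ℝ) : Continuous (generalMap C) := by
  refine continuous_pi fun l => (continuous_quadForm (C l)).comp
    (Continuous.prodMk ?_ (by fun_prop))
  exact (continuous_apply l).comp continuous_snd

lemma generalForms_eq {a d L : ℕ} {n : Fin a → ℕ} {r : Fin L → ℕ}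
    (C : (l : Fin L) → Matrix (Fin (r l)) (Fin a × Fin d) ℝ)
    (M : (s : ℕ) → Matrix (Fin s) (Fin a × Fin d) ℝ →
      Matrix (Fin a × Fin d) (Fin a × Fin d) ℝ → Matrix (Fin s) (Fin s) ℝ)
    (x : Sample n d) :
    generalForms C M x = generalMap C (√(totalSize n : ℝ) • meanVec x, fun l =>
      stdWeight (C l) (M (r l) (C l) (pooledCov x)) (pooledCov x)) := by
  ext l
  exact stdQuadForm_eq _ _ _ _ _

lemma integral_equalityLimit {a d : ℕ} (κ : Fin a → ℝ) (S : Fin a → Matrix (Fin d) (Fin d) ℝ)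
    (Mt : Matrix (Fin a) (Fin a) ℝ → Matrix (Fin a) (Fin a) ℝ → Matrix (Fin a) (Fin a) ℝ)
    (f : BoundedContinuousFunction (Fin d → ℝ) ℝ) :
    ∫ y, f y ∂equalityLimit κ S Mt = ∫ z, f (equalityMap a d (z, fun j =>
      (√(formVar (centering a) (Mt (centering a) (limitComponentCov κ S j))
        (limitComponentCov κ S j)))⁻¹ • Mt (centering a) (limitComponentCov κ S j)))
      ∂multivariateGaussian 0 (limitCov κ S) := by
  have h : equalityLimit κ S Mt = (multivariateGaussian 0 (limitCov κ S)).map fun z =>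
      equalityMap a d (z, fun j =>
        (√(formVar (centering a) (Mt (centering a) (limitComponentCov κ S j))
          (limitComponentCov κ S j)))⁻¹ • Mt (centering a) (limitComponentCov κ S j)) := by
    unfold equalityLimit
    congr 1
    ext z j
    exact (quadForm_smul _ _ _ _).symm
  have hc := (continuous_equalityMap a d).comp (Continuous.prodMk_left
    (X := EuclideanSpace ℝ (Fin a × Fin d)) fun j =>
      ((√(formVar (centering a) (Mt (centering a) (limitComponentCov κ S j))
        (limitComponentCov κ S j)))⁻¹ • Mt (centering a) (limitComponentCov κ S j) :
        Fin a → Fin a → ℝ))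
  rw [h]
  exact integral_map hc.measurable.aemeasurable f.continuous.measurable.aestronglyMeasurable

lemma integral_generalLimit {a d L : ℕ} {r : Fin L → ℕ} (κ : Fin a → ℝ)
    (S : Fin a → Matrix (Fin d) (Fin d) ℝ)
    (C : (l : Fin L) → Matrix (Fin (r l)) (Fin a × Fin d) ℝ)
    (M : (s : ℕ) → Matrix (Fin s) (Fin a × Fin d) ℝ →
      Matrix (Fin a × Fin d) (Fin a × Fin d) ℝ → Matrix (Fin s) (Fin s) ℝ)
    (f : BoundedContinuousFunction (Fin L → ℝ) ℝ) :
    ∫ y, f y ∂generalLimit κ S C M = ∫ z, f (generalMap C (z, fun l =>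
      (√(formVar (C l) (M (r l) (C l) (limitCov κ S)) (limitCov κ S)))⁻¹ •
        M (r l) (C l) (limitCov κ S))) ∂multivariateGaussian 0 (limitCov κ S) := by
  have h : generalLimit κ S C M = (multivariateGaussian 0 (limitCov κ S)).map fun z =>
      generalMap C (z, fun l =>
        (√(formVar (C l) (M (r l) (C l) (limitCov κ S)) (limitCov κ S)))⁻¹ •
          M (r l) (C l) (limitCov κ S)) := by
    unfold generalLimit
    congr 1
    ext z l
    exact (quadForm_smul _ _ _ _).symm
  have hc := (continuous_generalMap C).comp (Continuous.prodMk_left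
    (X := EuclideanSpace ℝ (Fin a × Fin d)) fun l =>
      ((√(formVar (C l) (M (r l) (C l) (limitCov κ S)) (limitCov κ S)))⁻¹ •
        M (r l) (C l) (limitCov κ S) : Fin (r l) → Fin (r l) → ℝ))
  rw [h]
  exact integral_map hc.measurable.aemeasurable f.continuous.measurable.aestronglyMeasurable

end QuadBootstrap

end

theorem mainTheorem2
    {Ω : Type*} [MeasurableSpace Ω] (P : Measure Ω) [IsProbabilityMeasure P]
    (a d : ℕ) (ha : 2 ≤ a)
    -- the model: `X i k = μ i + ε i k`
    (μ : Fin a → EuclideanSpace ℝ (Fin d))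
    (ε : Fin a → ℕ → Ω → EuclideanSpace ℝ (Fin d))
    (hε_meas : ∀ i k, Measurable (ε i k))
    (hε_indep : iIndepFun (fun p : Fin a × ℕ => ε p.1 p.2) P)
    (hε_ident : ∀ i j k k', IdentDistrib (fun ω => ε i k ω j) (fun ω => ε i k' ω j) P P)
    (hε_mean : ∀ i k j, ∫ ω, ε i k ω j ∂P = 0)
    -- group sizes along the asymptotics `N → ∞`, and (A1)
    (n : ℕ → Fin a → ℕ)
    (hN : Tendsto (fun m => QuadBootstrap.totalSize (n m)) atTop atTop)
    (κ : Fin a → ℝ) (hκ : ∀ i, κ i ∈ Set.Ioc (0 : ℝ) 1)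
    (hA1 : ∀ i, Tendsto (fun m => (n m i : ℝ) / (QuadBootstrap.totalSize (n m) : ℝ)) atTop
      (𝓝 (κ i)))
    -- (A2): finite second moments, with covariance matrix `S i` in group `i`
    (S : Fin a → Matrix (Fin d) (Fin d) ℝ)
    (hε_memLp : ∀ i k j, MemLp (fun ω => ε i k ω j) 2 P)
    (hA2 : ∀ i k j j', covariance (fun ω => ε i k ω j) (fun ω => ε i k ω j') P = S i j j')
    -- the data `X m` and the parametric bootstrap sample `Xs m` at stage `m`
    (X Xs : (m : ℕ) → Ω → QuadBootstrap.Sample (n m) d)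
    (hX : ∀ m ω i k, X m ω i k = μ i + ε i k ω)
    (hXs : ∀ m, QuadBootstrap.IsParametricBootstrap P (X m) (Xs m)) :
    -- (a)
    QuadBootstrap.CondTendstoWeakly P X
      (fun m ω => √(QuadBootstrap.totalSize (n m) : ℝ) • QuadBootstrap.meanVec (Xs m ω))
      (multivariateGaussian 0 (QuadBootstrap.limitCov κ S)) ∧
    -- (b)
    (∀ Mt : Matrix (Fin a) (Fin a) ℝ → Matrix (Fin a) (Fin a) ℝ → Matrix (Fin a) (Fin a) ℝ,
      (∀ j, QuadBootstrap.IsWeight (Mt (QuadBootstrap.centering a))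
        (QuadBootstrap.limitComponentCov κ S j)) →
      (∀ j, 0 < QuadBootstrap.formVar (QuadBootstrap.centering a)
        (Mt (QuadBootstrap.centering a) (QuadBootstrap.limitComponentCov κ S j))
        (QuadBootstrap.limitComponentCov κ S j)) →
      QuadBootstrap.CondTendstoWeakly P X
        (fun m ω => QuadBootstrap.equalityForms Mt (Xs m ω))
        (QuadBootstrap.equalityLimit κ S Mt)) ∧
    -- (c), under (A3)
    (∀ (L : ℕ) (r : Fin L → ℕ) (C : (l : Fin L) → Matrix (Fin (r l)) (Fin a × Fin d) ℝ)
      (M : (s : ℕ) → Matrix (Fin s) (Fin a × Fin d) ℝ →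
        Matrix (Fin a × Fin d) (Fin a × Fin d) ℝ → Matrix (Fin s) (Fin s) ℝ),
      (∀ l, QuadBootstrap.IsWeight (M (r l) (C l)) (QuadBootstrap.limitCov κ S)) →
      (∀ l, ∃ t : ℝ, t ≠ 0 ∧ Module.End.HasEigenvalue
        (Matrix.toLin' ((C l)ᵀ * M (r l) (C l) (QuadBootstrap.limitCov κ S) * C l *
          QuadBootstrap.limitCov κ S)) t) →
      QuadBootstrap.CondTendstoWeakly P X
        (fun m ω => QuadBootstrap.generalForms C M (Xs m ω))
        (QuadBootstrap.generalLimit κ S C M)) ∧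
    -- consistency of the bootstrap covariance estimator
    (∀ p q, TendstoInMeasure P (fun m ω => QuadBootstrap.pooledCov (Xs m ω) p q) atTop
      (fun _ => QuadBootstrap.limitCov κ S p q)) := by
  have hκ0 : ∀ i, 0 < κ i := fun i => (hκ i).1
  have hn := QuadBootstrap.tendsto_groupSize hκ0 hN hA1
  have hS : ∀ i, (S i).PosSemidef := fun i =>
    QuadBootstrap.covMatrix_posSemidef (hε_mean i 0) (hε_memLp i 0) (hA2 i 0)
  have hXm : ∀ m, Measurable (X m) := fun m => by
    refine measurable_pi_lambda _ fun i => measurable_pi_lambda _ fun k => ?_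
    simp only [hX]
    exact (hε_meas i k).const_add _
  obtain ⟨hker, hsub⟩ := QuadBootstrap.exists_subseq_tendsto_groupCov μ ε hε_indep hε_ident
    hε_mean hn hε_memLp hA2 hX
  have hnφ : ∀ {φ : ℕ → ℕ}, StrictMono φ → ∀ i, Tendsto (fun k => n (φ k) i) atTop atTop :=
    fun hφ i => (hn i).comp hφ.tendsto_atTop
  have hA1φ : ∀ {φ : ℕ → ℕ}, StrictMono φ → ∀ i, Tendsto (fun k => (n (φ k) i : ℝ) /
      (QuadBootstrap.totalSize (n (φ k)) : ℝ)) atTop (𝓝 (κ i)) :=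
    fun hφ i => (hA1 i).comp hφ.tendsto_atTop
  have hcov : ∀ {φ : ℕ → ℕ}, StrictMono φ → ∀ {A}, QuadBootstrap.IsCovSeq S A →
      ∀ᵐ G ∂QuadBootstrap.noise a d, ∀ i, Tendsto (fun k =>
        QuadBootstrap.groupCov (QuadBootstrap.coupled (n (φ k)) (A k) G) i) atTop (𝓝 (S i)) :=
    fun hφ _ hA => QuadBootstrap.ae_tendsto_groupCov_coupled (hnφ hφ) hS hA
  have hkerG : ∀ {φ : ℕ → ℕ} {A}, QuadBootstrap.IsCovSeq S A → ∀ G k i v, S i *ᵥ v = 0 →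
      QuadBootstrap.groupCov (QuadBootstrap.coupled (n (φ k)) (A k) G) i *ᵥ v = 0 :=
    fun hA G k i v hv => QuadBootstrap.groupCov_coupled_mulVec_eq_zero (hA.posSemidef k) G i
      (hA.ker k i v hv)
  refine ⟨?_, fun Mt hMt hv => ?_, fun L r C M hM hA3 => ?_, fun p q => ?_⟩
  · refine QuadBootstrap.condTendstoWeakly_of_bootLaw hXm hXs hker hsub
      (T := fun m x => √(QuadBootstrap.totalSize (n m) : ℝ) • QuadBootstrap.meanVec x)
      (fun m => (continuous_const_smul _).measurable.comp QuadBootstrap.measurable_meanVec)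
      fun φ hφ A hA f => ?_
    exact QuadBootstrap.tendsto_integral_bootLaw (n := fun k => n (φ k)) (hnφ hφ) hκ0 (hA1φ hφ)
      hS hA continuous_fst (K := fun _ _ => (0 : ℝ)) (fun _ => measurable_const)
      (.of_forall fun _ => tendsto_const_nhds) f
  · have hKm : ∀ m, Measurable fun (x : QuadBootstrap.Sample (n m) d) (j : Fin d)
        (s t : Fin a) => QuadBootstrap.stdWeight (QuadBootstrap.centering a)
          (Mt (QuadBootstrap.centering a) (QuadBootstrap.componentCov x j))
          (QuadBootstrap.componentCov x j) s t := fun m =>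
      measurable_pi_lambda _ fun j => measurable_pi_lambda _ fun s => measurable_pi_lambda _ fun t =>
        (hMt j).measurable_stdWeight (QuadBootstrap.measurable_componentCov j) s t
    refine QuadBootstrap.condTendstoWeakly_of_bootLaw hXm hXs hker hsub
      (T := fun m x => QuadBootstrap.equalityForms Mt x) (fun m => ?_) fun φ hφ A hA f => ?_
    · simp only [QuadBootstrap.equalityForms_eq]
      have hmv : Measurable fun x : QuadBootstrap.Sample (n m) d =>
          √(QuadBootstrap.totalSize (n m) : ℝ) • QuadBootstrap.meanVec x :=
        (continuous_const_smul _).measurable.comp QuadBootstrap.measurable_meanVec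
      exact (QuadBootstrap.continuous_equalityMap a d).measurable.comp (hmv.prodMk (hKm m))
    · simp only [QuadBootstrap.equalityForms_eq, QuadBootstrap.integral_equalityLimit]
      refine QuadBootstrap.tendsto_integral_bootLaw (n := fun k => n (φ k)) (hnφ hφ) hκ0
        (hA1φ hφ) hS hA (QuadBootstrap.continuous_equalityMap a d) (fun k => hKm (φ k)) ?_ f
      filter_upwards [hcov hφ hA] with G hG
      refine tendsto_pi_nhds.2 fun j => ?_
      exact (hMt j).tendsto_stdWeight (hv j)
        (fun k => QuadBootstrap.componentCov_posSemidef _ j)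
        (fun k v => QuadBootstrap.componentCov_mulVec_eq_zero hκ0 hS _ (hkerG hA G k) j v)
        (QuadBootstrap.tendsto_componentCov hκ0 (hA1φ hφ) hG j)
  · have hlc := QuadBootstrap.limitCov_posSemidef hκ0 hS
    have hv : ∀ l, 0 < QuadBootstrap.formVar (C l)
        (M (r l) (C l) (QuadBootstrap.limitCov κ S)) (QuadBootstrap.limitCov κ S) := by
      intro l
      obtain ⟨t, ht, hev⟩ := hA3 l
      exact QuadBootstrap.formVar_pos ((hM l).posSemidef _ hlc) hlc ht hev
    have hKm : ∀ m, Measurable fun (x : QuadBootstrap.Sample (n m) d) (l : Fin L)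
        (s t : Fin (r l)) => QuadBootstrap.stdWeight (C l)
          (M (r l) (C l) (QuadBootstrap.pooledCov x)) (QuadBootstrap.pooledCov x) s t := fun m =>
      measurable_pi_lambda _ fun l => measurable_pi_lambda _ fun s => measurable_pi_lambda _ fun t =>
        (hM l).measurable_stdWeight QuadBootstrap.measurable_pooledCov s t
    refine QuadBootstrap.condTendstoWeakly_of_bootLaw hXm hXs hker hsub
      (T := fun m x => QuadBootstrap.generalForms C M x) (fun m => ?_) fun φ hφ A hA f => ?_
    · simp only [QuadBootstrap.generalForms_eq]
      have hmv : Measurable fun x : QuadBootstrap.Sample (n m) d =>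
          √(QuadBootstrap.totalSize (n m) : ℝ) • QuadBootstrap.meanVec x :=
        (continuous_const_smul _).measurable.comp QuadBootstrap.measurable_meanVec
      exact (QuadBootstrap.continuous_generalMap C).measurable.comp (hmv.prodMk (hKm m))
    · simp only [QuadBootstrap.generalForms_eq, QuadBootstrap.integral_generalLimit]
      refine QuadBootstrap.tendsto_integral_bootLaw (n := fun k => n (φ k)) (hnφ hφ) hκ0
        (hA1φ hφ) hS hA (QuadBootstrap.continuous_generalMap C) (fun k => hKm (φ k)) ?_ f
      filter_upwards [hcov hφ hA] with G hG
      refine tendsto_pi_nhds.2 fun l => ?_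
      exact (hM l).tendsto_stdWeight (hv l) (fun k => QuadBootstrap.pooledCov_posSemidef _)
        (fun k v => QuadBootstrap.pooledCov_mulVec_eq_zero hκ0 _ (hkerG hA G k) v)
        (QuadBootstrap.tendsto_pooledCov hκ0 (hA1φ hφ) hG)
  · refine QuadBootstrap.CondTendstoWeakly.tendstoInMeasure hXm
      (fun m => (QuadBootstrap.measurable_pooledCov p q).comp (hXs m).measurable) ?_
    refine QuadBootstrap.condTendstoWeakly_of_bootLaw hXm hXs hker hsub
      (T := fun m x => QuadBootstrap.pooledCov x p q)
      (fun m => QuadBootstrap.measurable_pooledCov p q) fun φ hφ A hA f => ?_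
    have h := QuadBootstrap.tendsto_integral_bootLaw (n := fun k => n (φ k)) (hnφ hφ) hκ0
      (hA1φ hφ) hS hA continuous_snd (K := fun k x => QuadBootstrap.pooledCov x p q)
      (fun k => QuadBootstrap.measurable_pooledCov p q) (c := QuadBootstrap.limitCov κ S p q)
      (by
        filter_upwards [hcov hφ hA] with G hG
        exact tendsto_pi_nhds.1
          (tendsto_pi_nhds.1 (QuadBootstrap.tendsto_pooledCov hκ0 (hA1φ hφ) hG) p) q) f
    simpa using h
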